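/- Fix $a\in(0,1/4]$ and let $g:(0,1]\to[0,\infty)$ be a measurable function such that $\sup_{0<x\le 1}x\,g(x)<\infty$; the restriction of $g$ to $[a,1]$ is piecewise $C^2$ (that is, $[a,1]$ can be partitioned into finitely many subintervals such that $g$ is $C^2$ on the interior of each of them and $g,g',g''$ have finite one-sided limits at their endpoints); and, for some $\epsilon>0$, $g(x)\ge\epsilon$ for all $x\in[1-\epsilon,1]\cap(0,1]$. The integral $\int_0^1 g(x)\,dx$ may be finite or infinite. Put $$C(\theta)=\int_0^1(e^{\theta x}-1)\,g(x)\,dx\qquad(\theta\in\mathbb R),$$ and let $T$ be a real random variable that has the infinitely divisible law with Lévy measure $g(x)\,dx$ on $(0,1]$, that is, $\mathbb E\,e^{\theta T}=e^{C(\theta)}$ for all $\theta\in\mathbb R$. Then for each $u>0$ there is exactly one real $\beta=\beta(u)$ with $C'(\beta)=u$; put $\sigma_\beta=\sqrt{C''(\beta)}$. Moreover, apart from a possible atom at $0$, the law of $T$ is absolutely continuous with a (possibly defective) density $f\ge 0$ that can be chosen continuous on $(1,\infty)$, and for each such choice of $f$, as $u\to\infty$, $$f(u)=\frac{e^{C(\beta)-u\beta}}{\sqrt{2\pi}\,\sigma_\beta}\left(1+O\!\left(\frac1{\sqrt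 u}\right)\right),$$ $$P(T\ge u)=\frac1\beta\cdot\frac{e^{C(\beta)-u\beta}}{\sqrt{2\pi}\,\sigma_\beta}\left(1+O\!\left(\frac1{\sqrt u}\right)\right),$$ and hence $$P(T\ge u)=\frac{f(u)}{\beta}\left(1+O\!\left(\frac1{\sqrt u}\right)\right).$$ -/

import Mathlib

/-- `g` is piecewise `C^k` on `[a, b]`: there is a partition `a = t 0 < ⋯ < t n = b` such that `g` is
`C^k` on the interior of each of the `n` subintervals, and `g` and its first `k` derivatives have
finite one-sided limits (from inside the subinterval) at the endpoints of each subinterval.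
The values of `g` at the points `t i` themselves are arbitrary. -/
def LevyTail.PiecewiseContDiff (k : ℕ) (g : ℝ → ℝ) (a b : ℝ) : Prop :=
  ∃ (n : ℕ) (t : Fin (n + 1) → ℝ), StrictMono t ∧ t 0 = a ∧ t (Fin.last n) = b ∧
    ∀ i : Fin n,
      ContDiffOn ℝ k g (Set.Ioo (t i.castSucc) (t i.succ)) ∧
      ∀ j : ℕ, j ≤ k →
        (∃ l : ℝ, Filter.Tendsto (iteratedDeriv j g)
          (nhdsWithin (t i.castSucc) (Set.Ioi (t i.castSucc))) (nhds l)) ∧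
        (∃ l : ℝ, Filter.Tendsto (iteratedDeriv j g)
          (nhdsWithin (t i.succ) (Set.Iio (t i.succ))) (nhds l))

/-- The cumulant generating function `C(θ) = ∫_(0,1] (e^{θ x} - 1) g(x) dx` attached to the
Lévy density `g` on `(0, 1]`. -/
noncomputable def LevyTail.cumulant (g : ℝ → ℝ) (θ : ℝ) : ℝ :=
  ∫ x in Set.Ioc (0 : ℝ) 1, (Real.exp (θ * x) - 1) * g x

/-- The random variable `T` has the infinitely divisible law with Lévy measure `g(x) dx` on `(0, 1]`:
`E e^{θ T} = exp (C(θ))` for all real `θ`. As the right-hand side is not `0`, the integrability of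
`e^{θ T}` is part of the condition. -/
def LevyTail.HasLevyDensity {Ω : Type*} [MeasurableSpace Ω] (T : Ω → ℝ)
    (P : MeasureTheory.Measure Ω) (g : ℝ → ℝ) : Prop :=
  ∀ θ : ℝ, ProbabilityTheory.mgf T P θ = Real.exp (LevyTail.cumulant g θ)

/-- `f` is a (possibly defective) density of the law `μ` on `ℝ`: apart from a possible atom at `0`,
the measure `μ` is absolutely continuous with density `f`. -/
def LevyTail.IsDefectiveDensity (μ : MeasureTheory.Measure ℝ) (f : ℝ → ℝ) : Prop :=
  Measurable f ∧ (∀ x, 0 ≤ f x) ∧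
    μ = μ {0} • MeasureTheory.Measure.dirac (0 : ℝ) +
      MeasureTheory.volume.withDensity (fun x => ENNReal.ofReal (f x))

/-- `F(u) = G(u) (1 + O(r(u)))` as `u → ∞`. -/
def LevyTail.EqWithRelError (F G r : ℝ → ℝ) : Prop :=
  ∃ R : ℝ → ℝ, Asymptotics.IsBigO Filter.atTop R r ∧
    ∀ᶠ u in Filter.atTop, F u = G u * (1 + R u)

/-- The approximation `e^{C(β) - u β} / (√(2 π) σ_β)` with `σ_β² = C''(β)`. -/
noncomputable def LevyTail.saddle (g : ℝ → ℝ) (β u : ℝ) : ℝ :=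
  Real.exp (LevyTail.cumulant g β - u * β) /
    (Real.sqrt (2 * Real.pi) * Real.sqrt (deriv (deriv (LevyTail.cumulant g)) β))

/-!
Put `k x = x * g x`, a bounded function supported on `(0, 1]`, and `ν = k(x) dx`. Differentiating
`𝔼 e^{θT} = e^{C(θ)}` shows that the size-biased law is a convolution, `x μ(dx) = ν ∗ μ`. Hence `μ`
has a density `f` away from `0`, with `x f(x) = ∫ k(x - y) μ(dy)`, continuous for `x > 1`. Since
`k` lives on `(0, 1]`, size-biasing once more traps the density of `ν ∗ ν ∗ μ` between
`(x - 1) x f(x)` and `x² f(x)`, so it is enough to find the asymptotics of that density.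

Its advantage over `f` is that Fourier inversion at the saddle point `β` holds without any
smoothness of `g`: the exponentially tilted `k` is bounded with compact support, hence in `L²`, and
by Plancherel the transform of `k ⋆ k` is integrable. For `|t| ≤ 1/4` a Taylor expansion of `C` at
`β` gives the Gaussian main term. For `|t| ≥ 1/4` the lower bound `g ≥ ε` near `1` makes
`Re (C(β + it) - C(β)) ≤ -κ e^{β(1 - δ)}`, and this double exponential decay beats the growth
`e^{2β}` of the `L²` norm.

Keeping `β` fixed, one gets `e^{(u + y)β - C(β)} f(u + y)` for every `y ≥ 0` with an error
`O((1 + y) / u)`; integrating against `e^{-βy}` gives the tail probability.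
-/

namespace LevyTail

open MeasureTheory ProbabilityTheory Set Filter Topology FourierTransform SchwartzMap
open scoped Convolution ENNReal ContDiff
open Complex (I)

section Fourier

variable {V : Type*} [NormedAddCommGroup V] [InnerProductSpace ℝ V] [FiniteDimensional ℝ V]
  [MeasurableSpace V] [BorelSpace V]
  {F : Type*} [NormedAddCommGroup F] [InnerProductSpace ℂ F]

theorem continuous_convolution_of_integrable_of_bounded {𝕜 E E' G : Type*}
    [NontriviallyNormedField 𝕜] [NormedAddCommGroup E] [NormedSpace 𝕜 E] [NormedSpace ℝ E]
    [NormedAddCommGroup E'] [NormedSpace 𝕜 E']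
    [NormedAddCommGroup G] [NormedSpace 𝕜 G] [NormedSpace ℝ G]
    (L : E →L[𝕜] E' →L[𝕜] G) {w : V → E} {f : V → E'} {M : ℝ} (hw : Integrable w)
    (hf : AEStronglyMeasurable f) (hM : ∀ x, ‖f x‖ ≤ M) : Continuous (w ⋆[L] f) := by
  have hM_nonneg : 0 ≤ M := (norm_nonneg _).trans (hM 0)
  have convolutionExistsAt {v : V → E} (hv : Integrable v) (x : V) :
      ConvolutionExistsAt v f x L :=
    BddAbove.convolutionExistsAt L ⟨M, by rintro _ ⟨y, -, rfl⟩; exact hM y⟩ MeasurableSet.univ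
      (subset_univ _) hv.integrableOn hf
  refine continuous_of_uniform_approx_of_continuous fun s hs => ?_
  obtain ⟨ε, hε, hεs⟩ := Metric.mem_uniformity_dist.1 hs
  obtain ⟨v, hv_supp, hv_approx, hv_cont, hv_int⟩ := hw.exists_hasCompactSupport_integral_sub_le
    (ε := ε / (2 * (‖L‖ * M + 1))) (by positivity)
  have hf_loc : LocallyIntegrable f :=
    (locallyIntegrable_const M).mono hf
      (Eventually.of_forall fun x => (hM x).trans (le_abs_self M))
  refine ⟨v ⋆[L] f, hv_supp.continuous_convolution_left L hv_cont hf_loc, fun x => hεs ?_⟩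
  rw [dist_eq_norm, convolution_def, convolution_def,
    ← integral_sub (convolutionExistsAt hw x) (convolutionExistsAt hv_int x)]
  calc ‖∫ t, (L (w t) (f (x - t)) - L (v t) (f (x - t)))‖
      ≤ ∫ t, ‖L‖ * M * ‖w t - v t‖ := by
        refine norm_integral_le_of_norm_le ((hw.sub hv_int).norm.const_mul _)
          (Eventually.of_forall fun t => ?_)
        rw [← sub_apply, ← map_sub, mul_right_comm]
        exact (L.le_opNorm₂ _ _).trans (by gcongr; exact hM _)
    _ ≤ ‖L‖ * M * (ε / (2 * (‖L‖ * M + 1))) := by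
        rw [integral_const_mul]
        gcongr
    _ < ε := by
        have hLM : 0 ≤ ‖L‖ * M := by positivity
        rw [mul_div_assoc', div_lt_iff₀ (by positivity)]
        nlinarith

theorem continuous_fourier_of_integrable {q : V → F} (hq : Integrable q) : Continuous (𝓕 q) :=
  VectorFourier.fourierIntegral_continuous Real.continuous_fourierChar continuous_inner hq

theorem memLp_two_of_integrable_of_bounded {α E : Type*} [MeasurableSpace α] {μ : Measure α}
    [NormedAddCommGroup E] {q : α → E} {M : ℝ} (hq : Integrable q μ) (hM : ∀ x, ‖q x‖ ≤ M) :
    MemLp q 2 μ := by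
  refine (memLp_two_iff_integrable_sq_norm hq.aestronglyMeasurable).2 ?_
  simpa only [sq] using hq.norm.bdd_mul hq.aestronglyMeasurable.norm
    (Eventually.of_forall fun x => (norm_norm (q x)).trans_le (hM x))

theorem integral_norm_sq_coe_Lp {α : Type*} [MeasurableSpace α] {μ : Measure α} (f : Lp F 2 μ) :
    ∫ x, ‖f x‖ ^ 2 ∂μ = ‖f‖ ^ 2 := by
  have h := inner_self_eq_norm_sq_to_K (𝕜 := ℂ) f
  rw [L2.inner_def] at h
  simp only [inner_self_eq_norm_sq_to_K] at h
  have h' : ((∫ x, ‖f x‖ ^ 2 ∂μ : ℝ) : ℂ) = ((‖f‖ ^ 2 : ℝ) : ℂ) := by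
    rw [← integral_complex_ofReal]
    simpa using h
  exact_mod_cast h'

variable [CompleteSpace F]

theorem fourier_toLp_ae_eq {q : V → F} (hq : Integrable q) (hq2 : MemLp q 2) :
    ((𝓕 (hq2.toLp q) : Lp (α := V) F 2) : V → F) =ᵐ[volume] 𝓕 q := by
  refine ae_eq_of_integral_contDiff_smul_eq ((Lp.memLp _).locallyIntegrable (by norm_num))
    (continuous_fourier_of_integrable hq).locallyIntegrable fun g hg hg_supp => ?_
  have hg_supp' : HasCompactSupport (Complex.ofRealCLM ∘ g) := hg_supp.comp_left rfl
  have hg' : ContDiff ℝ ∞ (Complex.ofRealCLM ∘ g) := by fun_prop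
  let φ : 𝓢(V, ℂ) := hg_supp'.toSchwartzMap hg'
  have hdistr := DFunLike.congr_fun (Lp.fourier_toTemperedDistribution_eq (hq2.toLp q)) φ
  rw [TemperedDistribution.fourier_apply, Lp.toTemperedDistribution_apply,
    Lp.toTemperedDistribution_apply] at hdistr
  have hcoe : ∫ x, (𝓕 φ) x • (hq2.toLp q) x = ∫ x, (𝓕 φ) x • q x :=
    integral_congr_ae (hq2.coeFn_toLp.mono fun x hx => by simp only [hx])
  have hflip : ∫ x, (𝓕 φ) x • q x = ∫ x, φ x • 𝓕 q x := by
    simpa using! VectorFourier.integral_fourierIntegral_smul_eq_flip (L := innerₗ V)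
      Real.continuous_fourierChar continuous_inner φ.integrable hq
  rw [hcoe, hflip] at hdistr
  simpa [φ] using hdistr.symm

theorem integrable_norm_sq_fourier {q : V → F} (hq : Integrable q) (hq2 : MemLp q 2) :
    Integrable fun s => ‖𝓕 q s‖ ^ 2 :=
  (memLp_two_iff_integrable_sq_norm (continuous_fourier_of_integrable hq).aestronglyMeasurable).1
    ((memLp_congr_ae (fourier_toLp_ae_eq hq hq2)).1 (Lp.memLp _))

theorem integral_norm_sq_fourier {q : V → F} (hq : Integrable q) (hq2 : MemLp q 2) :
    ∫ s, ‖𝓕 q s‖ ^ 2 = ∫ x, ‖q x‖ ^ 2 := by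
  let Fq : Lp (α := V) F 2 := 𝓕 (hq2.toLp q)
  calc ∫ s, ‖𝓕 q s‖ ^ 2 = ∫ s, ‖Fq s‖ ^ 2 :=
        integral_congr_ae ((fourier_toLp_ae_eq hq hq2).mono fun s hs => by simp only [Fq, hs])
    _ = ∫ x, ‖hq2.toLp q x‖ ^ 2 := by
        rw [integral_norm_sq_coe_Lp, integral_norm_sq_coe_Lp, Lp.norm_fourier_eq]
    _ = ∫ x, ‖q x‖ ^ 2 :=
        integral_congr_ae (hq2.coeFn_toLp.mono fun x hx => by simp only [hx])

theorem integrable_fourier_sq {q : V → ℂ} (hq : Integrable q) (hq2 : MemLp q 2) :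
    Integrable fun s => 𝓕 q s ^ 2 := by
  have hmeas : AEStronglyMeasurable fun s => 𝓕 q s ^ 2 :=
    ((continuous_fourier_of_integrable hq).pow 2).aestronglyMeasurable
  refine (integrable_norm_iff hmeas).1 ?_
  simpa only [norm_pow] using integrable_norm_sq_fourier hq hq2

theorem convolution_self_eq_fourierInv_sq {q : V → ℂ} {M : ℝ} (hq : Integrable q)
    (hM : ∀ x, ‖q x‖ ≤ M) : q ⋆[ContinuousLinearMap.mul ℂ ℂ] q = 𝓕⁻ fun s => 𝓕 q s ^ 2 := by
  have hfourier : 𝓕 (q ⋆[ContinuousLinearMap.mul ℂ ℂ] q) = fun s => 𝓕 q s ^ 2 := by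
    ext s
    rw [Real.fourier_mul_convolution_eq hq hq, sq]
  have hfourier_int := integrable_fourier_sq hq (memLp_two_of_integrable_of_bounded hq hM)
  have hcont := continuous_convolution_of_integrable_of_bounded (ContinuousLinearMap.mul ℂ ℂ) hq
    hq.aestronglyMeasurable hM
  rw [← hfourier, hcont.fourierInv_fourier_eq (hq.integrable_convolution _ hq)
    (by rwa [hfourier])]

end Fourier

section Cumulant

variable {ν : Measure ℝ}

/-- The exponential moment `∫ xⁿ e^{β x} dν(x)`. -/
noncomputable def expMoment (ν : Measure ℝ) (n : ℕ) (β : ℝ) : ℝ :=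
  ∫ x, x ^ n * Real.exp (β * x) ∂ν

/-- The cumulant generating function of the infinitely divisible law with Lévy measure `ν(dx) / x`.
The measure `ν` is finite even when the Lévy measure is not. -/
noncomputable def levyCumulant (ν : Measure ℝ) (θ : ℝ) : ℝ :=
  ∫ x, (Real.exp (θ * x) - 1) / x ∂ν

/-- The extension of `levyCumulant ν` to complex arguments. -/
noncomputable def complexCumulant (ν : Measure ℝ) (z : ℂ) : ℂ :=
  ∫ x, (Complex.exp (z * x) - 1) / x ∂ν

theorem complexCumulant_ofReal (θ : ℝ) : complexCumulant ν θ = levyCumulant ν θ := by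
  rw [complexCumulant, levyCumulant, ← integral_complex_ofReal]
  simp

theorem complexMGF_id_ofReal (β : ℝ) : complexMGF id ν β = expMoment ν 0 β := by
  rw [complexMGF_ofReal]
  simp [mgf, expMoment]

theorem norm_complexMGF_le_expMoment (β t : ℝ) :
    ‖complexMGF id ν (β + t * I)‖ ≤ expMoment ν 0 β :=
  norm_complexMGF_le_mgf.trans (by simp [mgf, expMoment])

theorem expMoment_nonneg (hν : ∀ᵐ x ∂ν, x ∈ Ioc (0 : ℝ) 1) (n : ℕ) (β : ℝ) :
    0 ≤ expMoment ν n β :=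
  integral_nonneg_of_ae (hν.mono fun _ hx => mul_nonneg (pow_nonneg hx.1.le _) (Real.exp_pos _).le)

theorem cexp_add_mul_I_mul (β t x : ℝ) :
    Complex.exp ((β + t * I) * x) = Real.exp (β * x) * Complex.exp ((t * x : ℝ) * I) := by
  rw [Complex.ofReal_exp, ← Complex.exp_add]
  push_cast
  ring_nf

theorem exp_mul_le_exp_abs (β : ℝ) {x : ℝ} (hx : x ∈ Ioc (0 : ℝ) 1) :
    Real.exp (β * x) ≤ Real.exp |β| := by
  refine Real.exp_le_exp.2 ((le_abs_self _).trans ?_)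
  rw [abs_mul, abs_of_pos hx.1]
  exact mul_le_of_le_one_right (abs_nonneg _) hx.2

theorem norm_cexp_sub_one_div_le (z : ℂ) {x : ℝ} (hx : x ∈ Ioc (0 : ℝ) 1) :
    ‖(Complex.exp (z * x) - 1) / x‖ ≤ ‖z‖ * Real.exp ‖z‖ := by
  have hx_norm : ‖(x : ℂ)‖ = x := Complex.norm_of_nonneg hx.1.le
  have hexp : ‖Complex.exp (z * x) - 1‖ ≤ ‖z * x‖ * Real.exp ‖z * x‖ := by
    simpa using Complex.norm_exp_sub_sum_le_norm_mul_exp (z * x) 1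
  have hle : ‖z‖ * x ≤ ‖z‖ := mul_le_of_le_one_right (norm_nonneg _) hx.2
  rw [norm_div, hx_norm, div_le_iff₀ hx.1]
  rw [norm_mul, hx_norm] at hexp
  calc ‖Complex.exp (z * x) - 1‖ ≤ ‖z‖ * x * Real.exp (‖z‖ * x) := hexp
    _ ≤ ‖z‖ * x * Real.exp ‖z‖ :=
        mul_le_mul_of_nonneg_left (Real.exp_le_exp.2 hle) (mul_nonneg (norm_nonneg _) hx.1.le)
    _ = ‖z‖ * Real.exp ‖z‖ * x := by ring

theorem norm_cexp_mul_I_sub_taylor_le {y : ℝ} (hy : |y| ≤ 1) :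
    ‖Complex.exp (y * I) - (1 + y * I - y ^ 2 / 2)‖ ≤ 2 / 9 * |y| ^ 3 := by
  have hy_norm : ‖(y * I : ℂ)‖ = |y| := by simp
  have h := Complex.exp_bound (hy_norm.trans_le hy) (n := 3) (by norm_num)
  have hsum : ∑ m ∈ Finset.range 3, (y * I : ℂ) ^ m / m.factorial = 1 + y * I - y ^ 2 / 2 := by
    simp [Finset.sum_range_succ, Nat.factorial, mul_pow, sub_eq_add_neg, neg_div]
  rw [hsum, hy_norm] at h
  refine h.trans_eq ?_
  norm_num [Nat.factorial]
  ring

variable [IsFiniteMeasure ν]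

theorem integrable_pow_mul_exp (hν : ∀ᵐ x ∂ν, x ∈ Ioc (0 : ℝ) 1) (n : ℕ) (β : ℝ) :
    Integrable (fun x => x ^ n * Real.exp (β * x)) ν := by
  refine Integrable.of_bound (by fun_prop) (Real.exp |β|) (hν.mono fun x hx => ?_)
  rw [Real.norm_eq_abs, abs_mul, Real.abs_exp, abs_pow, abs_of_pos hx.1]
  exact (mul_le_of_le_one_left (Real.exp_pos _).le (pow_le_one₀ hx.1.le hx.2)).trans
    (exp_mul_le_exp_abs β hx)

theorem integrable_exp_mul (hν : ∀ᵐ x ∂ν, x ∈ Ioc (0 : ℝ) 1) (β : ℝ) :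
    Integrable (fun x => Real.exp (β * x)) ν := by
  simpa using integrable_pow_mul_exp hν 0 β

theorem integrable_cexp_mul (hν : ∀ᵐ x ∂ν, x ∈ Ioc (0 : ℝ) 1) (z : ℂ) :
    Integrable (fun x : ℝ => Complex.exp (z * x)) ν := by
  rw [← integrable_norm_iff (by fun_prop)]
  simpa [Complex.norm_exp] using integrable_exp_mul hν z.re

theorem integrable_cexp_sub_one_div (hν : ∀ᵐ x ∂ν, x ∈ Ioc (0 : ℝ) 1) (z : ℂ) :
    Integrable (fun x : ℝ => (Complex.exp (z * x) - 1) / x) ν :=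
  Integrable.of_bound (Measurable.aestronglyMeasurable (by fun_prop)) _
    (hν.mono fun _ hx => norm_cexp_sub_one_div_le z hx)

theorem expMoment_succ_le (hν : ∀ᵐ x ∂ν, x ∈ Ioc (0 : ℝ) 1) (n : ℕ) (β : ℝ) :
    expMoment ν (n + 1) β ≤ expMoment ν n β :=
  integral_mono_ae (integrable_pow_mul_exp hν _ β) (integrable_pow_mul_exp hν _ β)
    (hν.mono fun _ hx => mul_le_mul_of_nonneg_right
      (pow_le_pow_of_le_one hx.1.le hx.2 n.le_succ) (Real.exp_pos _).le)

theorem hasDerivAt_expMoment (hν : ∀ᵐ x ∂ν, x ∈ Ioc (0 : ℝ) 1) (n : ℕ) (β : ℝ) :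
    HasDerivAt (expMoment ν n) (expMoment ν (n + 1) β) β := by
  have huniv : integrableExpSet id ν = univ :=
    eq_univ_of_forall fun β => integrable_exp_mul hν β
  exact hasDerivAt_integral_pow_mul_exp_real (X := id) (by simp [huniv]) n

theorem hasDerivAt_complexCumulant (hν : ∀ᵐ x ∂ν, x ∈ Ioc (0 : ℝ) 1) (z : ℂ) :
    HasDerivAt (complexCumulant ν) (complexMGF id ν z) z := by
  have hderiv : ∀ᵐ x : ℝ ∂ν, ∀ w ∈ Metric.ball z 1,
      HasDerivAt (fun w : ℂ => (Complex.exp (w * x) - 1) / x) (Complex.exp (w * x)) w := by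
    filter_upwards [hν] with x hx w _
    have hx_ne : (x : ℂ) ≠ 0 := by exact_mod_cast hx.1.ne'
    simpa [hx_ne] using
      ((((hasDerivAt_id w).mul_const (x : ℂ)).cexp).sub_const 1).div_const (x : ℂ)
  have hbound : ∀ᵐ x : ℝ ∂ν, ∀ w ∈ Metric.ball z 1,
      ‖Complex.exp (w * x)‖ ≤ Real.exp (‖z‖ + 1) := by
    filter_upwards [hν] with x hx w hw
    rw [Complex.norm_exp]
    refine Real.exp_le_exp.2 ((Complex.re_le_norm _).trans ?_)
    rw [norm_mul, Complex.norm_of_nonneg hx.1.le]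
    rw [mem_ball_iff_norm] at hw
    linarith [mul_le_of_le_one_right (norm_nonneg w) hx.2, norm_sub_norm_le w z]
  simpa [complexMGF] using! (hasDerivAt_integral_of_dominated_loc_of_deriv_le
    (Metric.ball_mem_nhds z one_pos)
    (Eventually.of_forall fun w => (integrable_cexp_sub_one_div hν w).aestronglyMeasurable)
    (integrable_cexp_sub_one_div hν z) (by fun_prop) hbound (integrable_const _) hderiv).2

theorem hasDerivAt_levyCumulant (hν : ∀ᵐ x ∂ν, x ∈ Ioc (0 : ℝ) 1) (β : ℝ) :
    HasDerivAt (levyCumulant ν) (expMoment ν 0 β) β := by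
  simpa only [complexMGF_id_ofReal, complexCumulant_ofReal, Complex.ofReal_re] using
    (hasDerivAt_complexCumulant hν β).real_of_complex

theorem deriv_levyCumulant (hν : ∀ᵐ x ∂ν, x ∈ Ioc (0 : ℝ) 1) :
    deriv (levyCumulant ν) = expMoment ν 0 :=
  funext fun β => (hasDerivAt_levyCumulant hν β).deriv

theorem deriv_expMoment (hν : ∀ᵐ x ∂ν, x ∈ Ioc (0 : ℝ) 1) (n : ℕ) :
    deriv (expMoment ν n) = expMoment ν (n + 1) :=
  funext fun β => (hasDerivAt_expMoment hν n β).deriv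

theorem norm_complexMGF_sub_expMoment_le (hν : ∀ᵐ x ∂ν, x ∈ Ioc (0 : ℝ) 1) (β t : ℝ) :
    ‖complexMGF id ν (β + t * I) - expMoment ν 0 β‖ ≤ |t| * expMoment ν 1 β := by
  rw [← complexMGF_id_ofReal, complexMGF, complexMGF]
  simp only [id]
  rw [← integral_sub (integrable_cexp_mul hν _) (integrable_cexp_mul hν _), expMoment,
    ← integral_const_mul]
  refine norm_integral_le_of_norm_le ((integrable_pow_mul_exp hν _ _).const_mul _)
    (hν.mono fun x hx => ?_)
  have hosc : ‖Complex.exp ((t * x : ℝ) * I) - 1‖ ≤ |t| * x := by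
    have h := Real.norm_exp_I_mul_ofReal_sub_one_le (x := t * x)
    rwa [mul_comm I, Real.norm_eq_abs, abs_mul, abs_of_pos hx.1] at h
  calc ‖Complex.exp ((β + t * I) * x) - Complex.exp (β * x)‖
      = Real.exp (β * x) * ‖Complex.exp ((t * x : ℝ) * I) - 1‖ := by
        rw [cexp_add_mul_I_mul, ← Complex.ofReal_mul, ← Complex.ofReal_exp, ← mul_sub_one,
          norm_mul, Complex.norm_of_nonneg (Real.exp_pos _).le]
    _ ≤ Real.exp (β * x) * (|t| * x) := mul_le_mul_of_nonneg_left hosc (Real.exp_pos _).le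
    _ = |t| * (x ^ 1 * Real.exp (β * x)) := by ring

theorem integrable_exp_div_mul_cexp_sub_one (hν : ∀ᵐ x ∂ν, x ∈ Ioc (0 : ℝ) 1) (β t : ℝ) :
    Integrable (fun x : ℝ =>
      ((Real.exp (β * x) / x : ℝ) : ℂ) * (Complex.exp ((t * x : ℝ) * I) - 1)) ν := by
  refine ((integrable_cexp_sub_one_div hν (β + t * I)).sub
    (integrable_cexp_sub_one_div hν β)).congr (Eventually.of_forall fun x => ?_)
  simp only [Pi.sub_apply, cexp_add_mul_I_mul]
  push_cast
  ring

theorem complexCumulant_sub_eq_integral (hν : ∀ᵐ x ∂ν, x ∈ Ioc (0 : ℝ) 1) (β t : ℝ) :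
    complexCumulant ν (β + t * I) - complexCumulant ν β =
      ∫ x, ((Real.exp (β * x) / x : ℝ) : ℂ) * (Complex.exp ((t * x : ℝ) * I) - 1) ∂ν := by
  rw [complexCumulant, complexCumulant, ← integral_sub (integrable_cexp_sub_one_div hν _)
    (integrable_cexp_sub_one_div hν _)]
  refine integral_congr_ae (Eventually.of_forall fun x => ?_)
  simp only [cexp_add_mul_I_mul]
  push_cast
  ring

theorem complexCumulant_sub_taylor_eq_integral (hν : ∀ᵐ x ∂ν, x ∈ Ioc (0 : ℝ) 1) (β t : ℝ) :
    complexCumulant ν (β + t * I) - complexCumulant ν β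
        - (t * expMoment ν 0 β * I - t ^ 2 / 2 * expMoment ν 1 β) =
      ∫ x, ((Real.exp (β * x) / x : ℝ) : ℂ) * (Complex.exp ((t * x : ℝ) * I)
        - (1 + (t * x : ℝ) * I - (t * x : ℝ) ^ 2 / 2)) ∂ν := by
  have hint0 : Integrable (fun x : ℝ =>
      (t * I : ℂ) * ((x ^ 0 * Real.exp (β * x) : ℝ) : ℂ)) ν :=
    (integrable_pow_mul_exp hν _ _).ofReal.const_mul _
  have hint1 : Integrable (fun x : ℝ =>
      (t ^ 2 / 2 : ℂ) * ((x ^ 1 * Real.exp (β * x) : ℝ) : ℂ)) ν :=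
    (integrable_pow_mul_exp hν _ _).ofReal.const_mul _
  have hmoments : (t * expMoment ν 0 β * I - t ^ 2 / 2 * expMoment ν 1 β : ℂ) =
      ∫ x, ((t * I : ℂ) * ((x ^ 0 * Real.exp (β * x) : ℝ) : ℂ)
        - (t ^ 2 / 2 : ℂ) * ((x ^ 1 * Real.exp (β * x) : ℝ) : ℂ)) ∂ν := by
    rw [integral_sub hint0 hint1, integral_const_mul, integral_const_mul,
      integral_complex_ofReal, integral_complex_ofReal, expMoment, expMoment]
    ring
  rw [complexCumulant_sub_eq_integral hν, hmoments,
    ← integral_sub (integrable_exp_div_mul_cexp_sub_one hν β t) (hint0.sub' hint1)]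
  refine integral_congr_ae (hν.mono fun x hx => ?_)
  have hx_ne : (x : ℂ) ≠ 0 := by exact_mod_cast hx.1.ne'
  push_cast
  field_simp
  ring

theorem norm_complexCumulant_taylor_le (hν : ∀ᵐ x ∂ν, x ∈ Ioc (0 : ℝ) 1) (β : ℝ) {t : ℝ}
    (ht : |t| ≤ 1) :
    ‖complexCumulant ν (β + t * I) - complexCumulant ν β
        - (t * expMoment ν 0 β * I - t ^ 2 / 2 * expMoment ν 1 β)‖
      ≤ 2 / 9 * |t| ^ 3 * expMoment ν 0 β := by
  rw [complexCumulant_sub_taylor_eq_integral hν, expMoment, ← integral_const_mul]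
  refine norm_integral_le_of_norm_le ((integrable_pow_mul_exp hν _ _).const_mul _)
    (hν.mono fun x hx => ?_)
  have habs : |t * x| = |t| * x := by rw [abs_mul, abs_of_pos hx.1]
  have hsmall : |t * x| ≤ 1 :=
    habs.trans_le ((mul_le_of_le_one_right (abs_nonneg _) hx.2).trans ht)
  have hdiv : 0 ≤ Real.exp (β * x) / x := (div_pos (Real.exp_pos _) hx.1).le
  have hx_ne : x ≠ 0 := hx.1.ne'
  rw [norm_mul, Complex.norm_of_nonneg hdiv]
  calc _ ≤ Real.exp (β * x) / x * (2 / 9 * |t * x| ^ 3) :=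
        mul_le_mul_of_nonneg_left (norm_cexp_mul_I_sub_taylor_le hsmall) hdiv
    _ = 2 / 9 * |t| ^ 3 * (x ^ 2 * Real.exp (β * x)) := by
        rw [habs]
        field_simp
    _ ≤ 2 / 9 * |t| ^ 3 * (x ^ 0 * Real.exp (β * x)) := by
        gcongr ?_ * (?_ * _)
        exact pow_le_pow_of_le_one hx.1.le hx.2 (Nat.zero_le 2)

theorem re_complexCumulant_sub_le (hν : ∀ᵐ x ∂ν, x ∈ Ioc (0 : ℝ) 1) (β t : ℝ) :
    (complexCumulant ν (β + t * I) - complexCumulant ν β).re ≤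
      -∫ x, (1 - Real.cos (t * x)) * Real.exp (β * x) ∂ν := by
  have hint := integrable_exp_div_mul_cexp_sub_one hν β t
  have hint_cos : Integrable (fun x => (1 - Real.cos (t * x)) * Real.exp (β * x)) ν := by
    refine (integrable_exp_mul hν β).bdd_mul (c := 2) (by fun_prop)
      (Eventually.of_forall fun x => ?_)
    rw [Real.norm_eq_abs, abs_le]
    constructor <;> linarith [Real.neg_one_le_cos (t * x), Real.cos_le_one (t * x)]
  rw [complexCumulant_sub_eq_integral hν, ← integral_neg, ← RCLike.re_eq_complex_re,
    ← integral_re hint]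
  refine integral_mono_ae hint.re hint_cos.neg (hν.mono fun x hx => ?_)
  simp only [RCLike.re_eq_complex_re, Complex.re_ofReal_mul, Complex.sub_re,
    Complex.exp_ofReal_mul_I_re, Complex.one_re]
  have hdiv : Real.exp (β * x) ≤ Real.exp (β * x) / x :=
    le_div_self (Real.exp_pos _).le hx.1 hx.2
  nlinarith [Real.cos_le_one (t * x)]

theorem expMoment_zero_le_two_mul_add (hν : ∀ᵐ x ∂ν, x ∈ Ioc (0 : ℝ) 1) {β : ℝ} (hβ : 0 ≤ β) :
    expMoment ν 0 β ≤ 2 * expMoment ν 1 β + ν.real univ * Real.exp (β / 2) := by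
  have hint := (integrable_pow_mul_exp hν 1 β).const_mul 2
  calc expMoment ν 0 β ≤ ∫ x, 2 * (x ^ 1 * Real.exp (β * x)) + Real.exp (β / 2) ∂ν := by
        refine integral_mono_ae (integrable_pow_mul_exp hν 0 β) (hint.add (integrable_const _))
          (hν.mono fun x hx => ?_)
        simp only [pow_zero, one_mul, pow_one]
        rcases le_total x (1 / 2) with hx_le | hx_ge
        · have hexp : Real.exp (β * x) ≤ Real.exp (β / 2) := Real.exp_le_exp.2 (by nlinarith)
          linarith [mul_pos hx.1 (Real.exp_pos (β * x))]
        · nlinarith [Real.exp_pos (β * x), Real.exp_pos (β / 2)]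
    _ = 2 * expMoment ν 1 β + ν.real univ * Real.exp (β / 2) := by
        rw [integral_add hint (integrable_const _), integral_const_mul, integral_const,
          smul_eq_mul, expMoment]

theorem expMoment_pos (hν : ∀ᵐ x ∂ν, x ∈ Ioc (0 : ℝ) 1) (hν_ne : ν ≠ 0) (n : ℕ) (β : ℝ) :
    0 < expMoment ν n β := by
  have hpos : ∀ᵐ x ∂ν, 0 < x ^ n * Real.exp (β * x) :=
    hν.mono fun x hx => mul_pos (pow_pos hx.1 n) (Real.exp_pos _)
  refine (expMoment_nonneg hν n β).lt_of_ne fun hzero => hν_ne (ae_eq_bot.1 ?_)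
  have hae := (integral_eq_zero_iff_of_nonneg_ae (hpos.mono fun _ => le_of_lt)
    (integrable_pow_mul_exp hν n β)).1 hzero.symm
  exact eventually_false_iff_eq_bot.1 (by filter_upwards [hae, hpos] with x hx hx' using hx'.ne' hx)

theorem strictMono_expMoment (hν : ∀ᵐ x ∂ν, x ∈ Ioc (0 : ℝ) 1) (hν_ne : ν ≠ 0) (n : ℕ) :
    StrictMono (expMoment ν n) :=
  strictMono_of_hasDerivAt_pos (hasDerivAt_expMoment hν n) (expMoment_pos hν hν_ne (n + 1))

theorem tendsto_expMoment_atTop (hν : ∀ᵐ x ∂ν, x ∈ Ioc (0 : ℝ) 1) (hν_ne : ν ≠ 0) (n : ℕ) :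
    Tendsto (expMoment ν n) atTop atTop := by
  have hle (β : ℝ) : β * expMoment ν (n + 1) 0 ≤ expMoment ν n β := by
    rw [expMoment, ← integral_const_mul]
    refine integral_mono_ae ((integrable_pow_mul_exp hν _ 0).const_mul β)
      (integrable_pow_mul_exp hν n β) (hν.mono fun x hx => ?_)
    have hexp : β * x ≤ Real.exp (β * x) := by linarith [Real.add_one_le_exp (β * x)]
    calc β * (x ^ (n + 1) * Real.exp (0 * x)) = x ^ n * (β * x) := by
          rw [zero_mul, Real.exp_zero]
          ring
      _ ≤ x ^ n * Real.exp (β * x) := mul_le_mul_of_nonneg_left hexp (pow_nonneg hx.1.le n)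
  exact tendsto_atTop_mono hle (tendsto_id.atTop_mul_const (expMoment_pos hν hν_ne _ 0))

theorem tendsto_expMoment_atBot (hν : ∀ᵐ x ∂ν, x ∈ Ioc (0 : ℝ) 1) (n : ℕ) :
    Tendsto (expMoment ν n) atBot (𝓝 0) := by
  rw [← integral_zero ℝ ℝ (μ := ν)]
  refine tendsto_integral_filter_of_dominated_convergence (fun _ => 1)
    (Eventually.of_forall fun β => by fun_prop) ?_ (integrable_const _) ?_
  · filter_upwards [eventually_le_atBot 0] with β hβ
    filter_upwards [hν] with x hx
    rw [norm_mul, norm_pow, Real.norm_of_nonneg hx.1.le, Real.norm_of_nonneg (Real.exp_pos _).le]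
    exact mul_le_one₀ (pow_le_one₀ hx.1.le hx.2) (Real.exp_pos _).le
      (Real.exp_le_one_iff.2 (mul_nonpos_of_nonpos_of_nonneg hβ hx.1.le))
  · filter_upwards [hν] with x hx
    simpa using
      (Real.tendsto_exp_atBot.comp (tendsto_id.atBot_mul_const hx.1)).const_mul (x ^ n)

theorem existsUnique_expMoment_eq (hν : ∀ᵐ x ∂ν, x ∈ Ioc (0 : ℝ) 1) (hν_ne : ν ≠ 0) (n : ℕ)
    {u : ℝ} (hu : 0 < u) : ∃! β, expMoment ν n β = u := by
  have hcont : Continuous (expMoment ν n) :=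
    continuous_iff_continuousAt.2 fun β => (hasDerivAt_expMoment hν n β).continuousAt
  obtain ⟨β₁, hβ₁⟩ := ((tendsto_expMoment_atBot hν n).eventually_lt_const hu).exists
  obtain ⟨β₂, hβ₂⟩ := ((tendsto_expMoment_atTop hν hν_ne n).eventually_ge_atTop u).exists
  obtain ⟨β, hβ⟩ := mem_range_of_exists_le_of_exists_ge hcont ⟨β₁, hβ₁.le⟩ ⟨β₂, hβ₂⟩
  exact ⟨β, hβ, fun γ hγ => (strictMono_expMoment hν hν_ne n).injective (hγ.trans hβ.symm)⟩

theorem tendsto_atTop_of_expMoment_eq (hν : ∀ᵐ x ∂ν, x ∈ Ioc (0 : ℝ) 1) (hν_ne : ν ≠ 0) {n : ℕ}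
    {β : ℝ → ℝ} (hβ : ∀ u > 0, expMoment ν n (β u) = u) : Tendsto β atTop atTop := by
  refine tendsto_atTop.2 fun B => ?_
  filter_upwards [eventually_gt_atTop 0, eventually_ge_atTop (expMoment ν n B)] with u hu hB
  rwa [← hβ u hu, (strictMono_expMoment hν hν_ne n).le_iff_le] at hB

end Cumulant

section Cosine

theorem exists_abs_sin_le_mul {y₀ : ℝ} (hy₀ : 0 < y₀) :
    ∃ ρ < 1, ∀ y, y₀ ≤ y → |Real.sin y| ≤ ρ * y := by
  have hpi := Real.pi_gt_three
  have hmin : 0 < min 1 (y₀ / 2) := by positivity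
  have hcos : Real.cos (min 1 (y₀ / 2)) < 1 := by
    simpa using Real.cos_lt_cos_of_nonneg_of_le_pi_div_two le_rfl
      ((min_le_left 1 (y₀ / 2)).trans (by linarith)) hmin
  refine ⟨max (1 / 2) (Real.cos (min 1 (y₀ / 2))), max_lt (by norm_num) hcos, fun y hy => ?_⟩
  have hy_pos : 0 < y := hy₀.trans_le hy
  rcases le_total y 2 with hy2 | hy2
  · have hsin_nonneg : 0 ≤ Real.sin (y / 2) :=
      Real.sin_nonneg_of_nonneg_of_le_pi (by linarith) (by linarith)
    have hcos_nonneg : 0 ≤ Real.cos (y / 2) :=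
      Real.cos_nonneg_of_mem_Icc ⟨by linarith, by linarith⟩
    have hcos_le : Real.cos (y / 2) ≤ max (1 / 2) (Real.cos (min 1 (y₀ / 2))) :=
      (Real.cos_le_cos_of_nonneg_of_le_pi hmin.le (by linarith)
        ((min_le_right _ _).trans (by linarith))).trans (le_max_right _ _)
    have hsin_eq : Real.sin y = 2 * Real.sin (y / 2) * Real.cos (y / 2) := by
      rw [← Real.sin_two_mul, mul_div_cancel₀ y two_ne_zero]
    rw [hsin_eq, abs_of_nonneg (by positivity)]
    nlinarith [mul_le_mul (Real.sin_le (half_pos hy_pos).le) hcos_le hcos_nonneg (by linarith)]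
  · nlinarith [Real.abs_sin_le_one y, le_max_left (1 / 2) (Real.cos (min 1 (y₀ / 2)))]

theorem exists_integral_cos_le_mul {a b τ : ℝ} (hab : a < b) (hτ : 0 < τ) :
    ∃ ρ < 1, ∀ t : ℝ, τ ≤ |t| → ∫ x in a..b, Real.cos (t * x) ≤ ρ * (b - a) := by
  have hba : 0 < b - a := sub_pos.2 hab
  obtain ⟨ρ, hρ, hsin⟩ := exists_abs_sin_le_mul (y₀ := τ * (b - a) / 2) (by positivity)
  refine ⟨ρ, hρ, fun t ht => ?_⟩
  have ht_pos : 0 < |t| := hτ.trans_le ht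
  have ht_ne : t ≠ 0 := abs_pos.1 ht_pos
  have hsin_t : |Real.sin (t * (b - a) / 2)| ≤ ρ * (|t| * (b - a) / 2) := by
    have h := hsin (|t| * (b - a) / 2) (by gcongr)
    rcases abs_choice t with habs | habs <;> rw [habs] at h ⊢
    · exact h
    · rw [neg_mul, neg_div] at h ⊢
      rwa [Real.sin_neg, abs_neg] at h
  have hintegral : ∫ x in a..b, Real.cos (t * x) =
      2 * Real.sin (t * (b - a) / 2) * Real.cos (t * (b + a) / 2) / t := by
    rw [intervalIntegral.integral_comp_mul_left Real.cos ht_ne, integral_cos, Real.sin_sub_sin,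
      smul_eq_mul, inv_mul_eq_div, ← mul_sub, ← mul_add]
  rw [hintegral]
  calc _ ≤ |2 * Real.sin (t * (b - a) / 2) * Real.cos (t * (b + a) / 2) / t| := le_abs_self _
    _ = 2 * |Real.sin (t * (b - a) / 2)| * |Real.cos (t * (b + a) / 2)| / |t| := by
        rw [abs_div, abs_mul, abs_mul, abs_two]
    _ ≤ 2 * (ρ * (|t| * (b - a) / 2)) * 1 / |t| := by
        gcongr
        · exact mul_nonneg zero_le_two ((abs_nonneg _).trans hsin_t)
        · exact Real.abs_cos_le_one _
    _ = ρ * (b - a) := by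
        field_simp

end Cosine

section Kernel

/-- A measurable function with values in `[0, M]`, supported on `(0, 1]`; it plays the role of
`x ↦ x g(x)` for a Lévy density `g`. -/
structure IsBoundedKernel (k : ℝ → ℝ) (M : ℝ) : Prop where
  measurable : Measurable k
  nonneg : ∀ x, 0 ≤ k x
  le : ∀ x, k x ≤ M
  eq_zero : ∀ x, x ∉ Ioc (0 : ℝ) 1 → k x = 0

/-- A bounded kernel which is at least `δ` on `[1 - δ, 1]`. The bound `δ ≤ 1 / 4` makes
`e^{β (1 - δ)}` outgrow `e^{β / 2}`. -/
structure IsLevyKernel (k : ℝ → ℝ) (M δ : ℝ) : Prop extends IsBoundedKernel k M where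
  pos : 0 < δ
  le_quarter : δ ≤ 1 / 4
  ge : ∀ x ∈ Icc (1 - δ) 1, δ ≤ k x

/-- The measure `k(x) dx`. -/
noncomputable def kernelMeasure (k : ℝ → ℝ) : Measure ℝ :=
  volume.withDensity fun x => ENNReal.ofReal (k x)

variable {k : ℝ → ℝ} {M δ : ℝ}

namespace IsBoundedKernel

theorem bound_nonneg (hk : IsBoundedKernel k M) : 0 ≤ M := (hk.nonneg 0).trans (hk.le 0)

theorem norm_le (hk : IsBoundedKernel k M) (x : ℝ) : ‖k x‖ ≤ M :=
  (Real.norm_of_nonneg (hk.nonneg x)).trans_le (hk.le x)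

theorem integrable_mul (hk : IsBoundedKernel k M) {F : ℝ → ℝ} (hF : Measurable F) {B : ℝ}
    (hB : ∀ x ∈ Ioc (0 : ℝ) 1, |F x| ≤ B) : Integrable fun x => k x * F x := by
  have hbound : Integrable ((Ioc (0 : ℝ) 1).indicator fun _ => M * B) :=
    (integrable_indicator_iff measurableSet_Ioc).2 (integrableOn_const (by simp))
  refine hbound.mono' (hk.measurable.mul hF).aestronglyMeasurable (Eventually.of_forall fun x => ?_)
  by_cases hx : x ∈ Ioc (0 : ℝ) 1
  · rw [indicator_of_mem hx, norm_mul]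
    exact mul_le_mul (hk.norm_le x) (hB x hx) (norm_nonneg _) hk.bound_nonneg
  · simp [hk.eq_zero x hx, indicator_of_notMem hx]

theorem integrable (hk : IsBoundedKernel k M) : Integrable k := by
  simpa using hk.integrable_mul (F := fun _ => 1) measurable_const (B := 1) (by simp)

theorem isFiniteMeasure (hk : IsBoundedKernel k M) : IsFiniteMeasure (kernelMeasure k) :=
  isFiniteMeasure_withDensity_ofReal hk.integrable.2

theorem ae_mem_Ioc (hk : IsBoundedKernel k M) : ∀ᵐ x ∂(kernelMeasure k), x ∈ Ioc (0 : ℝ) 1 := by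
  rw [kernelMeasure, ae_withDensity_iff hk.measurable.ennreal_ofReal]
  refine Eventually.of_forall fun x hx => ?_
  contrapose! hx
  simp [hk.eq_zero x hx]

theorem integral_kernelMeasure {E : Type*} [NormedAddCommGroup E] [NormedSpace ℝ E]
    (hk : IsBoundedKernel k M) (F : ℝ → E) :
    ∫ x, F x ∂(kernelMeasure k) = ∫ x, k x • F x := by
  rw [kernelMeasure, integral_withDensity_eq_integral_toReal_smul hk.measurable.ennreal_ofReal
    (Eventually.of_forall fun x => ENNReal.ofReal_lt_top)]
  simp only [ENNReal.toReal_ofReal (hk.nonneg _)]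

end IsBoundedKernel

namespace IsLevyKernel

theorem mul_intervalIntegral_le (hk : IsLevyKernel k M δ) {F : ℝ → ℝ} (hF : Continuous F)
    (hF_nonneg : ∀ x, 0 ≤ F x) :
    δ * ∫ x in (1 - δ)..1, F x ≤ ∫ x, F x ∂(kernelMeasure k) := by
  obtain ⟨B, hB⟩ := (isCompact_Icc (a := (0 : ℝ)) (b := 1)).exists_bound_of_continuousOn
    hF.continuousOn
  have hint : Integrable fun x => k x * F x :=
    hk.integrable_mul hF.measurable fun x hx => hB x ⟨hx.1.le, hx.2⟩
  rw [hk.integral_kernelMeasure, intervalIntegral.integral_of_le (by linarith [hk.pos]),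
    ← integral_const_mul]
  calc ∫ x in Ioc (1 - δ) 1, δ * F x ≤ ∫ x in Ioc (1 - δ) 1, k x * F x :=
        setIntegral_mono_on
          ((continuous_const.mul hF).integrableOn_Icc.mono_set Ioc_subset_Icc_self)
          hint.integrableOn measurableSet_Ioc fun x hx =>
            mul_le_mul_of_nonneg_right (hk.ge x ⟨hx.1.le, hx.2⟩) (hF_nonneg x)
    _ ≤ ∫ x, k x • F x := setIntegral_le_integral hint
        (Eventually.of_forall fun x => mul_nonneg (hk.nonneg x) (hF_nonneg x))

theorem expMoment_zero_ge (hk : IsLevyKernel k M δ) {β : ℝ} (hβ : 0 ≤ β) :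
    δ ^ 2 * Real.exp (β * (1 - δ)) ≤ expMoment (kernelMeasure k) 0 β := by
  have hexp : δ * Real.exp (β * (1 - δ)) ≤ ∫ x in (1 - δ)..1, Real.exp (β * x) := by
    have h := intervalIntegral.integral_mono_on (μ := volume) (a := 1 - δ) (b := 1)
      (f := fun _ => Real.exp (β * (1 - δ))) (g := fun x => Real.exp (β * x))
      (by linarith [hk.pos]) (by simp) (Continuous.intervalIntegrable (by fun_prop) _ _)
      fun x hx => Real.exp_le_exp.2 (mul_le_mul_of_nonneg_left hx.1 hβ)
    simpa using h
  calc δ ^ 2 * Real.exp (β * (1 - δ)) = δ * (δ * Real.exp (β * (1 - δ))) := by ring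
    _ ≤ δ * ∫ x in (1 - δ)..1, Real.exp (β * x) := mul_le_mul_of_nonneg_left hexp hk.pos.le
    _ ≤ ∫ x, Real.exp (β * x) ∂(kernelMeasure k) :=
        hk.mul_intervalIntegral_le (by fun_prop) fun x => (Real.exp_pos _).le
    _ = expMoment (kernelMeasure k) 0 β := by simp only [expMoment, pow_zero, one_mul]

theorem kernelMeasure_ne_zero (hk : IsLevyKernel k M δ) : kernelMeasure k ≠ 0 := by
  intro hzero
  have hge := hk.expMoment_zero_ge le_rfl
  rw [hzero, zero_mul, Real.exp_zero, mul_one, expMoment, integral_zero_measure] at hge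
  exact hge.not_gt (pow_pos hk.pos 2)

theorem mul_exp_le_integral_one_sub_cos_mul_exp (hk : IsLevyKernel k M δ) {β t ρ : ℝ} (hβ : 0 ≤ β)
    (hρ : ∫ x in (1 - δ)..1, Real.cos (t * x) ≤ ρ * δ) :
    δ * ((1 - ρ) * δ) * Real.exp (β * (1 - δ)) ≤
      ∫ x, (1 - Real.cos (t * x)) * Real.exp (β * x) ∂(kernelMeasure k) := by
  have hcos (x : ℝ) : 0 ≤ 1 - Real.cos (t * x) := by linarith [Real.cos_le_one (t * x)]
  have hlower : (1 - ρ) * δ ≤ ∫ x in (1 - δ)..1, (1 - Real.cos (t * x)) := by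
    rw [intervalIntegral.integral_sub (by simp) (Continuous.intervalIntegrable (by fun_prop) _ _),
      intervalIntegral.integral_const, smul_eq_mul]
    linarith
  have hexp : (∫ x in (1 - δ)..1, (1 - Real.cos (t * x))) * Real.exp (β * (1 - δ)) ≤
      ∫ x in (1 - δ)..1, (1 - Real.cos (t * x)) * Real.exp (β * x) := by
    rw [← intervalIntegral.integral_mul_const]
    exact intervalIntegral.integral_mono_on (by linarith [hk.pos])
      (Continuous.intervalIntegrable (by fun_prop) _ _)
      (Continuous.intervalIntegrable (by fun_prop) _ _) fun x hx =>
        mul_le_mul_of_nonneg_left (Real.exp_le_exp.2 (mul_le_mul_of_nonneg_left hx.1 hβ)) (hcos x)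
  calc δ * ((1 - ρ) * δ) * Real.exp (β * (1 - δ))
      ≤ δ * ∫ x in (1 - δ)..1, (1 - Real.cos (t * x)) * Real.exp (β * x) := by
        rw [mul_assoc]
        exact mul_le_mul_of_nonneg_left
          ((mul_le_mul_of_nonneg_right hlower (Real.exp_pos _).le).trans hexp) hk.pos.le
    _ ≤ _ := hk.mul_intervalIntegral_le (by fun_prop) fun x =>
        mul_nonneg (hcos x) (Real.exp_pos _).le

theorem exists_norm_cexp_complexCumulant_sub_le (hk : IsLevyKernel k M δ) {τ : ℝ} (hτ : 0 < τ) :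
    ∃ κ > 0, ∀ β t : ℝ, 0 ≤ β → τ ≤ |t| →
      ‖Complex.exp (complexCumulant (kernelMeasure k) (β + t * I)
        - complexCumulant (kernelMeasure k) β)‖ ≤ Real.exp (-(κ * Real.exp (β * (1 - δ)))) := by
  have := hk.isFiniteMeasure
  obtain ⟨ρ, hρ, hcos⟩ := exists_integral_cos_le_mul (sub_lt_self 1 hk.pos) hτ
  rw [sub_sub_cancel] at hcos
  refine ⟨δ * ((1 - ρ) * δ), mul_pos hk.pos (mul_pos (sub_pos.2 hρ) hk.pos), fun β t hβ ht => ?_⟩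
  rw [Complex.norm_exp, Real.exp_le_exp]
  exact (re_complexCumulant_sub_le hk.ae_mem_Ioc β t).trans
    (neg_le_neg (hk.mul_exp_le_integral_one_sub_cos_mul_exp hβ (hcos t ht)))

theorem eventually_expMoment_zero_div_four_le (hk : IsLevyKernel k M δ) :
    ∀ᶠ β in atTop, expMoment (kernelMeasure k) 0 β / 4 ≤ expMoment (kernelMeasure k) 1 β := by
  have := hk.isFiniteMeasure
  set m := (kernelMeasure k).real univ
  have htendsto : Tendsto (fun β : ℝ => δ ^ 2 * Real.exp (β / 4)) atTop atTop :=
    (Real.tendsto_exp_atTop.comp (tendsto_id.atTop_div_const four_pos)).const_mul_atTop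
      (pow_pos hk.pos 2)
  filter_upwards [eventually_ge_atTop 0, htendsto.eventually_ge_atTop (2 * m)] with β hβ hm
  have hsmall : 2 * (m * Real.exp (β / 2)) ≤ expMoment (kernelMeasure k) 0 β := by
    calc 2 * (m * Real.exp (β / 2)) = 2 * m * Real.exp (β / 2) := by ring
      _ ≤ δ ^ 2 * Real.exp (β / 4) * Real.exp (β / 2) :=
          mul_le_mul_of_nonneg_right hm (Real.exp_pos _).le
      _ = δ ^ 2 * Real.exp (β / 4 + β / 2) := by rw [Real.exp_add, mul_assoc]
      _ ≤ δ ^ 2 * Real.exp (β * (1 - δ)) := by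
          gcongr
          nlinarith [hk.le_quarter]
      _ ≤ expMoment (kernelMeasure k) 0 β := hk.expMoment_zero_ge hβ
  linarith [expMoment_zero_le_two_mul_add hk.ae_mem_Ioc hβ]

end IsLevyKernel

end Kernel

section Tilt

/-- The exponentially tilted kernel `e^{βx} k(x)`, complex valued so that its Fourier transform can
be taken. -/
noncomputable def expTilt (k : ℝ → ℝ) (β x : ℝ) : ℂ := (Real.exp (β * x) * k x : ℝ)

namespace IsBoundedKernel

variable {k : ℝ → ℝ} {M : ℝ}

theorem norm_expTilt_le (hk : IsBoundedKernel k M) (β x : ℝ) :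
    ‖expTilt k β x‖ ≤ Real.exp |β| * M := by
  rw [expTilt, Complex.norm_real, norm_mul, Real.norm_eq_abs, Real.abs_exp]
  by_cases hx : x ∈ Ioc (0 : ℝ) 1
  · exact mul_le_mul (exp_mul_le_exp_abs β hx) (hk.norm_le x) (norm_nonneg _) (Real.exp_pos _).le
  · rw [hk.eq_zero x hx, norm_zero, mul_zero]
    exact mul_nonneg (Real.exp_pos |β|).le hk.bound_nonneg

theorem integrable_expTilt (hk : IsBoundedKernel k M) (β : ℝ) : Integrable (expTilt k β) := by
  have hint : Integrable fun x => Real.exp (β * x) * k x := by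
    simp_rw [mul_comm (Real.exp _)]
    refine hk.integrable_mul (by fun_prop) (B := Real.exp |β|) fun x hx => ?_
    rw [Real.abs_exp]
    exact exp_mul_le_exp_abs β hx
  exact hint.ofReal (𝕜 := ℂ)

theorem memLp_two_expTilt (hk : IsBoundedKernel k M) (β : ℝ) : MemLp (expTilt k β) 2 :=
  memLp_two_of_integrable_of_bounded (hk.integrable_expTilt β) (hk.norm_expTilt_le β)

theorem fourier_expTilt (hk : IsBoundedKernel k M) (β s : ℝ) :
    𝓕 (expTilt k β) s =
      complexMGF id (kernelMeasure k) (β + ((-(2 * Real.pi) * s : ℝ) : ℂ) * I) := by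
  rw [complexMGF, hk.integral_kernelMeasure, Real.fourier_eq']
  congr 1 with x
  simp only [expTilt, smul_eq_mul, RCLike.inner_apply, conj_trivial, id, Complex.real_smul]
  rw [add_mul, Complex.exp_add]
  push_cast
  ring_nf

theorem integrable_norm_sq_complexMGF (hk : IsBoundedKernel k M) (β : ℝ) :
    Integrable fun t : ℝ => ‖complexMGF id (kernelMeasure k) (β + t * I)‖ ^ 2 := by
  have hfourier := integrable_norm_sq_fourier (hk.integrable_expTilt β) (hk.memLp_two_expTilt β)
  simp only [hk.fourier_expTilt] at hfourier
  exact (integrable_comp_mul_left_iff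
    (fun t : ℝ => ‖complexMGF id (kernelMeasure k) (β + t * I)‖ ^ 2)
    (neg_ne_zero.2 Real.two_pi_pos.ne')).1 hfourier

theorem integral_norm_sq_complexMGF_eq (hk : IsBoundedKernel k M) (β : ℝ) :
    ∫ t : ℝ, ‖complexMGF id (kernelMeasure k) (β + t * I)‖ ^ 2 =
      2 * Real.pi * ∫ x, ‖expTilt k β x‖ ^ 2 := by
  have hplancherel := integral_norm_sq_fourier (hk.integrable_expTilt β) (hk.memLp_two_expTilt β)
  simp only [hk.fourier_expTilt] at hplancherel
  rw [← hplancherel, Measure.integral_comp_mul_left (fun t : ℝ =>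
    ‖complexMGF id (kernelMeasure k) (β + t * I)‖ ^ 2), abs_inv, abs_neg,
    abs_of_pos Real.two_pi_pos, smul_eq_mul, mul_inv_cancel_left₀ Real.two_pi_pos.ne']

theorem integral_norm_sq_expTilt_le (hk : IsBoundedKernel k M) (β : ℝ) :
    ∫ x, ‖expTilt k β x‖ ^ 2 ≤ (Real.exp |β| * M) ^ 2 := by
  have hsupport : (fun x => ‖expTilt k β x‖ ^ 2) =
      (Ioc (0 : ℝ) 1).indicator fun x => ‖expTilt k β x‖ ^ 2 := by
    refine (indicator_eq_self.2 fun x hx => ?_).symm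
    by_contra hx_mem
    simp [expTilt, hk.eq_zero x hx_mem] at hx
  rw [hsupport, integral_indicator measurableSet_Ioc]
  refine (Real.le_norm_self _).trans ((norm_setIntegral_le_of_norm_le_const
    (C := (Real.exp |β| * M) ^ 2) (by simp) fun x _ => ?_).trans_eq (by simp))
  rw [norm_pow, norm_norm]
  exact pow_le_pow_left₀ (norm_nonneg _) (hk.norm_expTilt_le β x) 2

theorem integral_norm_sq_complexMGF_le (hk : IsBoundedKernel k M) (β : ℝ) :
    ∫ t : ℝ, ‖complexMGF id (kernelMeasure k) (β + t * I)‖ ^ 2 ≤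
      2 * Real.pi * (Real.exp |β| * M) ^ 2 := by
  rw [hk.integral_norm_sq_complexMGF_eq]
  exact mul_le_mul_of_nonneg_left (hk.integral_norm_sq_expTilt_le β) Real.two_pi_pos.le

end IsBoundedKernel

end Tilt

section Law

theorem eq_of_forall_ofReal_eq {F G : ℂ → ℂ} (hF : Differentiable ℂ F) (hG : Differentiable ℂ G)
    (h : ∀ x : ℝ, F x = G x) : F = G := by
  refine AnalyticOnNhd.eq_of_frequently_eq (z₀ := 0)
    (hF.differentiableOn.analyticOnNhd isOpen_univ) (hG.differentiableOn.analyticOnNhd isOpen_univ)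
    ?_
  have htendsto : Tendsto ((↑) : ℝ → ℂ) (𝓝[≠] 0) (𝓝[≠] 0) :=
    tendsto_nhdsWithin_iff.2 ⟨(Complex.continuous_ofReal.tendsto' 0 0 rfl).mono_left inf_le_left,
      eventually_mem_nhdsWithin.mono fun x hx => Complex.ofReal_ne_zero.2 hx⟩
  exact htendsto.frequently (Eventually.of_forall h).frequently

theorem measure_Iio_zero_eq_zero_of_mgf_le_one {μ : Measure ℝ} [IsFiniteMeasure μ]
    (hint : ∀ t, Integrable (fun x => Real.exp (t * x)) μ) (hle : ∀ t ≤ 0, mgf id μ t ≤ 1) :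
    μ (Iio 0) = 0 := by
  have hIic : ∀ e < 0, μ (Iic e) = 0 := by
    intro e he
    have hbound : ∀ n : ℕ, μ.real (Iic e) ≤ Real.exp (e * n) := fun n => by
      have hn : -(n : ℝ) ≤ 0 := neg_nonpos.2 n.cast_nonneg
      refine (measure_le_le_exp_mul_mgf (X := id) e hn (hint _)).trans ?_
      refine (mul_le_of_le_one_right (Real.exp_pos _).le (hle _ hn)).trans_eq ?_
      rw [neg_neg, mul_comm]
    have htendsto : Tendsto (fun n : ℕ => Real.exp (e * n)) atTop (𝓝 0) :=
      Real.tendsto_exp_atBot.comp (tendsto_natCast_atTop_atTop.const_mul_atTop_of_neg he)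
    exact (measureReal_eq_zero_iff).1
      (le_antisymm (ge_of_tendsto' htendsto hbound) measureReal_nonneg)
  refine measure_mono_null (t := ⋃ n : ℕ, Iic (-(1 / ((n : ℝ) + 1)))) (fun x hx => ?_)
    (measure_iUnion_null fun n => hIic _ (neg_neg_of_pos Nat.one_div_pos_of_nat))
  obtain ⟨n, hn⟩ := exists_nat_one_div_lt (show 0 < -x from neg_pos.2 hx)
  exact mem_iUnion.2 ⟨n, (lt_neg_of_lt_neg hn).le⟩

/-- `μ` has the moment generating function of the infinitely divisible law with Lévy measure
`x⁻¹ ν(dx)`. -/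
def IsLevyLaw (μ ν : Measure ℝ) : Prop :=
  ∀ θ : ℝ, mgf id μ θ = Real.exp (levyCumulant ν θ)

namespace IsLevyLaw

variable {μ ν : Measure ℝ}

theorem integrable_exp (h : IsLevyLaw μ ν) (θ : ℝ) : Integrable (fun x => Real.exp (θ * x)) μ := by
  by_contra hint
  exact (Real.exp_pos _).ne ((mgf_undef (X := id) hint).symm.trans (h θ))

theorem mem_interior_integrableExpSet (h : IsLevyLaw μ ν) (θ : ℝ) :
    θ ∈ interior (integrableExpSet id μ) := by
  rw [show integrableExpSet id μ = univ from eq_univ_of_forall h.integrable_exp, interior_univ]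
  exact mem_univ θ

theorem isProbabilityMeasure (h : IsLevyLaw μ ν) : IsProbabilityMeasure μ := by
  have hone := h 0
  simp only [mgf_zero', levyCumulant, zero_mul, Real.exp_zero, sub_self, zero_div,
    integral_zero] at hone
  exact ⟨(ENNReal.toReal_eq_one_iff _).1 hone⟩

theorem complexMGF_eq [IsFiniteMeasure ν] (h : IsLevyLaw μ ν)
    (hν : ∀ᵐ x ∂ν, x ∈ Ioc (0 : ℝ) 1) :
    complexMGF id μ = fun z => Complex.exp (complexCumulant ν z) := by
  refine eq_of_forall_ofReal_eq
    (fun z => (hasDerivAt_complexMGF (h.mem_interior_integrableExpSet _)).differentiableAt)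
    (fun z => (hasDerivAt_complexCumulant hν z).differentiableAt.cexp) fun x => ?_
  rw [complexMGF_ofReal, h x, complexCumulant_ofReal, Complex.ofReal_exp]

theorem measure_Iio_zero (h : IsLevyLaw μ ν) (hν : ∀ᵐ x ∂ν, x ∈ Ioc (0 : ℝ) 1) :
    μ (Iio 0) = 0 := by
  have := h.isProbabilityMeasure
  refine measure_Iio_zero_eq_zero_of_mgf_le_one h.integrable_exp fun t ht => ?_
  rw [h, Real.exp_le_one_iff]
  refine integral_nonpos_of_ae (hν.mono fun x hx => ?_)
  exact div_nonpos_of_nonpos_of_nonneg (sub_nonpos.2 (Real.exp_le_one_iff.2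
    (mul_nonpos_of_nonpos_of_nonneg ht hx.1.le))) hx.1.le

theorem ae_nonneg (h : IsLevyLaw μ ν) (hν : ∀ᵐ x ∂ν, x ∈ Ioc (0 : ℝ) 1) : ∀ᵐ x ∂μ, 0 ≤ x := by
  rw [ae_iff]
  simpa only [not_le, ← Iio_def] using h.measure_Iio_zero hν

/-- The size-bias identity `x μ(dx) = ν ∗ μ`, obtained by differentiating `log 𝔼 e^{zX}`. -/
theorem withDensity_ofReal_eq_conv [IsFiniteMeasure ν] (h : IsLevyLaw μ ν)
    (hν : ∀ᵐ x ∂ν, x ∈ Ioc (0 : ℝ) 1) : μ.withDensity ENNReal.ofReal = ν ∗ μ := by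
  have := h.isProbabilityMeasure
  have hid : Integrable (fun x : ℝ => x) μ := by
    simpa using integrable_pow_of_mem_interior_integrableExpSet (X := id)
      (h.mem_interior_integrableExpSet 0) 1
  have := isFiniteMeasure_withDensity_ofReal hid.2
  refine Measure.ext_of_charFun (funext fun t => ?_)
  have hderiv : ∫ x, (x : ℂ) * Complex.exp (t * I * x) ∂μ =
      complexMGF id μ (t * I) * complexMGF id ν (t * I) := by
    refine (hasDerivAt_complexMGF (X := id) (h.mem_interior_integrableExpSet _)).unique ?_
    rw [h.complexMGF_eq hν]
    exact (hasDerivAt_complexCumulant hν (t * I)).cexp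
  rw [charFun_conv, ← complexMGF_id_mul_I, ← complexMGF_id_mul_I, ← complexMGF_id_mul_I,
    mul_comm (complexMGF id ν _), ← hderiv, complexMGF,
    integral_withDensity_eq_integral_toReal_smul ENNReal.measurable_ofReal
      (Eventually.of_forall fun x => ENNReal.ofReal_lt_top)]
  refine integral_congr_ae ((h.ae_nonneg hν).mono fun x hx => ?_)
  simp [ENNReal.toReal_ofReal hx]

end IsLevyLaw

theorem conv_eq_withDensity_lintegral {μ : Measure ℝ} [SFinite μ] {p : ℝ → ℝ≥0∞}
    (hp : Measurable p) :
    volume.withDensity p ∗ μ = volume.withDensity fun x => ∫⁻ y, p (x - y) ∂μ := by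
  have hp_sub : Measurable fun q : ℝ × ℝ => p (q.1 - q.2) := by fun_prop
  refine Measure.ext_of_lintegral _ fun f hf => ?_
  rw [Measure.conv_comm, Measure.lintegral_conv hf,
    lintegral_withDensity_eq_lintegral_mul _ hp_sub.lintegral_prod_right' hf]
  calc ∫⁻ y, ∫⁻ x, f (y + x) ∂(volume.withDensity p) ∂μ
      = ∫⁻ y, (∫⁻ x, p (x - y) * f x) ∂μ := by
        congr 1 with y
        rw [lintegral_withDensity_eq_lintegral_mul _ hp (by fun_prop),
          ← lintegral_add_left_eq_self (fun x => p (x - y) * f x) y]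
        simp only [Pi.mul_apply, add_sub_cancel_left]
    _ = ∫⁻ x, ∫⁻ y, p (x - y) * f x ∂μ :=
        lintegral_lintegral_swap
          ((hp_sub.comp measurable_swap).mul (hf.comp measurable_snd)).aemeasurable
    _ = ∫⁻ x, (∫⁻ y, p (x - y) ∂μ) * f x := by
        congr 1 with x
        exact lintegral_mul_const _ (hp.comp (measurable_const.sub measurable_id))

end Law

section Density

variable {k : ℝ → ℝ} {M : ℝ} {μ : Measure ℝ}

/-- The density `x ↦ ∫ k(x - y) dμ(y)` of the convolution `(k dx) ∗ μ`. -/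
noncomputable def convDensity (k : ℝ → ℝ) (μ : Measure ℝ) (x : ℝ) : ℝ := ∫ y, k (x - y) ∂μ

namespace IsBoundedKernel

theorem measurable_sub (hk : IsBoundedKernel k M) (x : ℝ) : Measurable fun y => k (x - y) :=
  hk.measurable.comp (measurable_const.sub measurable_id)

theorem integrable_sub [IsFiniteMeasure μ] (hk : IsBoundedKernel k M) (x : ℝ) :
    Integrable (fun y => k (x - y)) μ :=
  Integrable.of_bound (hk.measurable_sub x).aestronglyMeasurable M
    (Eventually.of_forall fun _ => hk.norm_le _)

theorem convDensity_nonneg (hk : IsBoundedKernel k M) (x : ℝ) : 0 ≤ convDensity k μ x :=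
  integral_nonneg fun _ => hk.nonneg _

theorem measurable_convDensity [SFinite μ] (hk : IsBoundedKernel k M) :
    Measurable (convDensity k μ) := by
  have hk_sub : Measurable fun p : ℝ × ℝ => k (p.1 - p.2) :=
    hk.measurable.comp (measurable_fst.sub measurable_snd)
  exact (hk_sub.stronglyMeasurable.integral_prod_right' (ν := μ)).measurable

theorem kernelMeasure_conv_eq [IsFiniteMeasure μ] (hk : IsBoundedKernel k M) :
    kernelMeasure k ∗ μ = volume.withDensity fun x => ENNReal.ofReal (convDensity k μ x) := by
  rw [kernelMeasure, conv_eq_withDensity_lintegral hk.measurable.ennreal_ofReal]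
  congr 1 with x
  exact (ofReal_integral_eq_lintegral_ofReal (hk.integrable_sub x)
    (Eventually.of_forall fun _ => hk.nonneg _)).symm

end IsBoundedKernel

theorem eq_smul_dirac_add_restrict_Ioi (hμ : μ (Iio 0) = 0) :
    μ = μ {0} • Measure.dirac 0 + μ.restrict (Ioi 0) := by
  have hae : ∀ᵐ x ∂μ, x ∈ Ici (0 : ℝ) := by
    rw [ae_iff]
    simpa only [mem_Ici, not_le, ← Iio_def] using hμ
  rw [← Measure.restrict_singleton, ← Measure.restrict_union (by simp) measurableSet_Ioi,
    singleton_union, Ioi_insert, Measure.restrict_eq_self_of_ae_mem hae]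

theorem restrict_Ioi_eq_withDensity_indicator {p : ℝ → ℝ} (hp : Measurable p)
    (h : μ.withDensity ENNReal.ofReal = volume.withDensity fun x => ENNReal.ofReal (p x)) :
    μ.restrict (Ioi 0) =
      volume.withDensity fun x => ENNReal.ofReal ((Ioi 0).indicator (fun x => p x / x) x) := by
  have hpos : ∀ᵐ x ∂(μ.restrict (Ioi 0)), ENNReal.ofReal x ≠ 0 :=
    (ae_restrict_mem measurableSet_Ioi).mono fun x hx => (ENNReal.ofReal_pos.2 hx).ne'
  have hinv : Measurable fun x : ℝ => (ENNReal.ofReal x)⁻¹ := ENNReal.measurable_ofReal.inv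
  calc μ.restrict (Ioi 0)
      = ((μ.restrict (Ioi 0)).withDensity ENNReal.ofReal).withDensity
          fun x => (ENNReal.ofReal x)⁻¹ :=
        (withDensity_inv_same ENNReal.measurable_ofReal hpos
          (Eventually.of_forall fun x => ENNReal.ofReal_ne_top)).symm
    _ = (volume.restrict (Ioi 0)).withDensity
          ((fun x => ENNReal.ofReal (p x)) * fun x => (ENNReal.ofReal x)⁻¹) := by
        rw [← restrict_withDensity measurableSet_Ioi, h, restrict_withDensity measurableSet_Ioi,
          withDensity_mul _ hp.ennreal_ofReal hinv]
    _ = _ := by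
        rw [← withDensity_indicator measurableSet_Ioi]
        congr 1 with x
        by_cases hx : x ∈ Ioi (0 : ℝ)
        · rw [indicator_of_mem hx, indicator_of_mem hx, Pi.mul_apply, ENNReal.ofReal_div_of_pos hx,
            ENNReal.div_eq_inv_mul, mul_comm]
        · rw [indicator_of_notMem hx, indicator_of_notMem hx, ENNReal.ofReal_zero]

namespace IsLevyLaw

theorem withDensity_ofReal_eq (h : IsLevyLaw μ (kernelMeasure k)) (hk : IsBoundedKernel k M) :
    μ.withDensity ENNReal.ofReal =
      volume.withDensity fun x => ENNReal.ofReal (convDensity k μ x) := by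
  have := h.isProbabilityMeasure
  have := hk.isFiniteMeasure
  rw [h.withDensity_ofReal_eq_conv hk.ae_mem_Ioc, hk.kernelMeasure_conv_eq]

theorem isDefectiveDensity (h : IsLevyLaw μ (kernelMeasure k)) (hk : IsBoundedKernel k M) :
    IsDefectiveDensity μ ((Ioi 0).indicator fun x => convDensity k μ x / x) := by
  have := h.isProbabilityMeasure
  have hconv := hk.measurable_convDensity (μ := μ)
  refine ⟨(hconv.div measurable_id).indicator measurableSet_Ioi, fun x => ?_, ?_⟩
  · exact indicator_nonneg (fun x hx => div_nonneg (hk.convDensity_nonneg x) (le_of_lt hx)) x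
  · rw [← restrict_Ioi_eq_withDensity_indicator hconv (h.withDensity_ofReal_eq hk)]
    exact eq_smul_dirac_add_restrict_Ioi (h.measure_Iio_zero hk.ae_mem_Ioc)

end IsLevyLaw

namespace IsDefectiveDensity

variable {f : ℝ → ℝ}

theorem integrable [IsFiniteMeasure μ] (hf : IsDefectiveDensity μ f) : Integrable f := by
  have hle : volume.withDensity (fun x => ENNReal.ofReal (f x)) ≤ μ := by
    conv_rhs => rw [hf.2.2]
    exact Measure.le_add_left le_rfl
  refine ⟨hf.1.aestronglyMeasurable, ?_⟩
  rw [hasFiniteIntegral_iff_ofReal (Eventually.of_forall hf.2.1), ← setLIntegral_univ,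
    ← withDensity_apply _ MeasurableSet.univ]
  exact (hle univ).trans_lt (measure_lt_top μ univ)

theorem integral_eq (hf : IsDefectiveDensity μ f) {F : ℝ → ℝ}
    (hF : Integrable F μ) : ∫ x, F x ∂μ = μ.real {0} * F 0 + ∫ x, f x * F x := by
  rw [hf.2.2] at hF
  conv_lhs => rw [hf.2.2]
  rw [integral_add_measure hF.left_of_add_measure hF.right_of_add_measure, integral_smul_measure,
    integral_dirac, integral_withDensity_eq_integral_toReal_smul hf.1.ennreal_ofReal
      (Eventually.of_forall fun x => ENNReal.ofReal_lt_top)]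
  simp only [ENNReal.toReal_ofReal (hf.2.1 _), smul_eq_mul, measureReal_def]

theorem withDensity_ofReal_eq (hf : IsDefectiveDensity μ f) :
    μ.withDensity ENNReal.ofReal =
      volume.withDensity ((fun x => ENNReal.ofReal (f x)) * ENNReal.ofReal) := by
  have hdirac : (Measure.dirac (0 : ℝ)).withDensity ENNReal.ofReal = 0 := by
    rw [withDensity_congr_ae (g := 0) (by rw [EventuallyEq, ae_dirac_eq]; simp), withDensity_zero]
  conv_lhs => rw [hf.2.2]
  rw [withDensity_add_measure, withDensity_smul_measure, hdirac, smul_zero, zero_add,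
    withDensity_mul _ hf.1.ennreal_ofReal ENNReal.measurable_ofReal]

theorem ae_mul_eq_convDensity (hf : IsDefectiveDensity μ f) (h : IsLevyLaw μ (kernelMeasure k))
    (hk : IsBoundedKernel k M) : ∀ᵐ x : ℝ, 0 < x → x * f x = convDensity k μ x := by
  have := h.isProbabilityMeasure
  have hae := (withDensity_eq_iff_of_sigmaFinite
    (hf.1.ennreal_ofReal.mul ENNReal.measurable_ofReal).aemeasurable
    hk.measurable_convDensity.ennreal_ofReal.aemeasurable).1
      (hf.withDensity_ofReal_eq.symm.trans (h.withDensity_ofReal_eq hk))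
  filter_upwards [hae] with x hx hx_pos
  rw [Pi.mul_apply, ← ENNReal.ofReal_mul (hf.2.1 x), ENNReal.ofReal_eq_ofReal_iff
    (mul_nonneg (hf.2.1 x) hx_pos.le) (hk.convDensity_nonneg x)] at hx
  rw [mul_comm, hx]

theorem convDensity_eq_convolution [IsFiniteMeasure μ] (hf : IsDefectiveDensity μ f)
    (hk : IsBoundedKernel k M) {x : ℝ} (hx : 1 < x) :
    convDensity k μ x = (f ⋆[ContinuousLinearMap.mul ℝ ℝ] k) x := by
  rw [convDensity, hf.integral_eq (hk.integrable_sub x), sub_zero,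
    hk.eq_zero x fun hx_mem => hx.not_ge hx_mem.2, mul_zero, zero_add]
  rfl

theorem continuousOn_convDensity [IsFiniteMeasure μ] (hf : IsDefectiveDensity μ f)
    (hk : IsBoundedKernel k M) : ContinuousOn (convDensity k μ) (Ioi 1) :=
  (continuous_convolution_of_integrable_of_bounded (ContinuousLinearMap.mul ℝ ℝ) hf.integrable
    hk.measurable.aestronglyMeasurable hk.norm_le).continuousOn.congr
      fun _ hx => hf.convDensity_eq_convolution hk hx

theorem mul_eq_convDensity (hf : IsDefectiveDensity μ f) (h : IsLevyLaw μ (kernelMeasure k))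
    (hk : IsBoundedKernel k M) (hf_cont : ContinuousOn f (Ioi 1)) {x : ℝ} (hx : 1 < x) :
    x * f x = convDensity k μ x := by
  have := h.isProbabilityMeasure
  refine Measure.eqOn_open_of_ae_eq (μ := volume) (U := Ioi 1) (f := fun x => x * f x) ?_
    isOpen_Ioi (continuousOn_id.mul hf_cont) (hf.continuousOn_convDensity hk) hx
  rw [EventuallyEq, ae_restrict_iff' measurableSet_Ioi]
  filter_upwards [hf.ae_mul_eq_convDensity h hk] with y hy hy_one
  exact hy (zero_lt_one.trans hy_one)

end IsDefectiveDensity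

namespace IsLevyLaw

theorem convDensity_conv_eq (h : IsLevyLaw μ (kernelMeasure k)) (hk : IsBoundedKernel k M) (x : ℝ) :
    convDensity k (kernelMeasure k ∗ μ) x = ∫ y, y * k (x - y) ∂μ := by
  have := hk.isFiniteMeasure
  rw [convDensity, ← h.withDensity_ofReal_eq_conv hk.ae_mem_Ioc,
    integral_withDensity_eq_integral_toReal_smul ENNReal.measurable_ofReal
      (Eventually.of_forall fun x => ENNReal.ofReal_lt_top)]
  refine integral_congr_ae ((h.ae_nonneg hk.ae_mem_Ioc).mono fun y hy => ?_)
  simp only [ENNReal.toReal_ofReal hy, smul_eq_mul]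

theorem convDensity_conv_mem_Icc (h : IsLevyLaw μ (kernelMeasure k)) (hk : IsBoundedKernel k M)
    (x : ℝ) :
    convDensity k (kernelMeasure k ∗ μ) x ∈
      Icc ((x - 1) * convDensity k μ x) (x * convDensity k μ x) := by
  have := h.isProbabilityMeasure
  have hpointwise (y : ℝ) :
      (x - 1) * k (x - y) ≤ y * k (x - y) ∧ y * k (x - y) ≤ x * k (x - y) := by
    by_cases hy : x - y ∈ Ioc (0 : ℝ) 1
    · exact ⟨mul_le_mul_of_nonneg_right (by linarith [hy.2]) (hk.nonneg _),
        mul_le_mul_of_nonneg_right (by linarith [hy.1]) (hk.nonneg _)⟩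
    · simp [hk.eq_zero _ hy]
  have hint : Integrable (fun y => k (x - y)) μ := hk.integrable_sub x
  have hint_mul : Integrable (fun y => y * k (x - y)) μ := by
    refine (hint.const_mul (|x| + 1)).mono'
      (measurable_id.mul (hk.measurable_sub x)).aestronglyMeasurable
      (Eventually.of_forall fun y => abs_le.2 ⟨?_, ?_⟩)
    · nlinarith [hpointwise y, hk.nonneg (x - y), neg_abs_le x]
    · nlinarith [hpointwise y, hk.nonneg (x - y), le_abs_self x]
  rw [h.convDensity_conv_eq hk, convDensity, ← integral_const_mul, ← integral_const_mul]
  exact ⟨integral_mono (hint.const_mul _) hint_mul fun y => (hpointwise y).1,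
    integral_mono hint_mul (hint.const_mul _) fun y => (hpointwise y).2⟩

end IsLevyLaw

end Density

section Inversion

variable {μ : Measure ℝ}

theorem integral_cexp_mul_fourierInv_sub [SFinite μ] {β : ℝ}
    (hμ : Integrable (fun z => Real.exp (β * z)) μ) {Q : ℝ → ℂ} (hQ : Integrable Q) (x : ℝ) :
    ∫ z : ℝ, Complex.exp (β * z) * 𝓕⁻ Q (x - z) ∂μ =
      ∫ s : ℝ, Complex.exp (2 * Real.pi * s * x * I) * Q s *
        complexMGF id μ (β + ((-(2 * Real.pi) * s : ℝ) : ℂ) * I) := by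
  have hint : Integrable (Function.uncurry fun z s : ℝ =>
      Complex.exp (β * z) * Q s * Complex.exp (↑(2 * Real.pi * s * (x - z)) * I))
      (μ.prod volume) := by
    refine Integrable.mul_bdd (c := 1) ?_ (by fun_prop)
      (Eventually.of_forall fun p => (Complex.norm_exp_ofReal_mul_I _).le)
    have hexp : Integrable (fun z : ℝ => Complex.exp (β * z)) μ := by
      simpa using hμ.ofReal (𝕜 := ℂ)
    exact hexp.mul_prod hQ
  calc ∫ z : ℝ, Complex.exp (β * z) * 𝓕⁻ Q (x - z) ∂μ
      = ∫ z : ℝ, (∫ s : ℝ, Complex.exp (β * z) * Q s *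
          Complex.exp (↑(2 * Real.pi * s * (x - z)) * I)) ∂μ := by
        congr 1 with z
        rw [Real.fourierInv_eq', ← integral_const_mul]
        congr 1 with s
        simp only [RCLike.inner_apply, conj_trivial, smul_eq_mul]
        ring_nf
    _ = ∫ s : ℝ, ∫ z : ℝ, Complex.exp (β * z) * Q s *
          Complex.exp (↑(2 * Real.pi * s * (x - z)) * I) ∂μ := integral_integral_swap hint
    _ = _ := by
        congr 1 with s
        rw [complexMGF, ← integral_const_mul]
        congr 1 with z
        rw [mul_right_comm, mul_right_comm _ (Q s), ← Complex.exp_add, ← Complex.exp_add]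
        congr 2
        push_cast [id]
        ring

variable {k : ℝ → ℝ} {M : ℝ}

theorem IsBoundedKernel.exp_mul_convDensity_conv_eq [IsFiniteMeasure μ] (hk : IsBoundedKernel k M)
    (β x : ℝ) :
    ((Real.exp (β * x) * convDensity k (kernelMeasure k ∗ μ) x : ℝ) : ℂ) =
      ∫ z : ℝ, Complex.exp (β * z) *
        (expTilt k β ⋆[ContinuousLinearMap.mul ℂ ℂ] expTilt k β) (x - z) ∂μ := by
  have := hk.isFiniteMeasure
  rw [convDensity, Measure.conv_comm, integral_conv (hk.integrable_sub x), ← integral_const_mul,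
    ← integral_complex_ofReal]
  congr 1 with z
  rw [hk.integral_kernelMeasure, convolution_def, ← integral_const_mul, ← integral_const_mul,
    ← integral_complex_ofReal]
  congr 1 with y
  have hexp : Real.exp (β * x) =
      Real.exp (β * z) * (Real.exp (β * y) * Real.exp (β * (x - z - y))) := by
    rw [← Real.exp_add, ← Real.exp_add]
    ring_nf
  rw [hexp, ContinuousLinearMap.mul_apply', expTilt, expTilt, sub_sub x z y]
  push_cast [smul_eq_mul]
  ring

/-- The integrand of the Fourier inversion formula for the density of `ν ∗ ν ∗ μ` at `x`, where `μ`
is the law with Lévy measure `x⁻¹ ν(dx)`; the factor `e^{Λ(β)}`, with `Λ = levyCumulant ν`, is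
divided out. -/
noncomputable def inversionIntegrand (ν : Measure ℝ) (β x t : ℝ) : ℂ :=
  complexMGF id ν (β + t * I) ^ 2 *
    Complex.exp (complexCumulant ν (β + t * I) - complexCumulant ν β - t * x * I)

theorem IsLevyLaw.convDensity_conv_eq_integral_inversionIntegrand
    (h : IsLevyLaw μ (kernelMeasure k)) (hk : IsBoundedKernel k M) (β x : ℝ) :
    (convDensity k (kernelMeasure k ∗ μ) x : ℂ) =
      (Real.exp (levyCumulant (kernelMeasure k) β - x * β) / (2 * Real.pi) : ℝ) *
        ∫ t, inversionIntegrand (kernelMeasure k) β x t := by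
  have := hk.isFiniteMeasure
  have := h.isProbabilityMeasure
  set ν := kernelMeasure k
  have hintegrand (s : ℝ) :
      Complex.exp (2 * Real.pi * s * x * I) * 𝓕 (expTilt k β) s ^ 2 *
          complexMGF id μ (β + ((-(2 * Real.pi) * s : ℝ) : ℂ) * I) =
        Complex.exp (complexCumulant ν β) * inversionIntegrand ν β x (-(2 * Real.pi) * s) := by
    rw [hk.fourier_expTilt, h.complexMGF_eq hk.ae_mem_Ioc, inversionIntegrand, mul_right_comm,
      ← Complex.exp_add, mul_left_comm, ← Complex.exp_add, mul_comm]
    congr 2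
    push_cast
    ring
  have hinversion : ((Real.exp (β * x) * convDensity k (ν ∗ μ) x : ℝ) : ℂ) =
      Complex.exp (complexCumulant ν β) *
        ((2 * Real.pi)⁻¹ * ∫ t, inversionIntegrand ν β x t) := by
    rw [hk.exp_mul_convDensity_conv_eq, convolution_self_eq_fourierInv_sq
      (hk.integrable_expTilt β) (hk.norm_expTilt_le β), integral_cexp_mul_fourierInv_sub
      (h.integrable_exp β) (integrable_fourier_sq (hk.integrable_expTilt β)
        (hk.memLp_two_expTilt β))]
    simp_rw [hintegrand]
    rw [integral_const_mul, Measure.integral_comp_mul_left, Complex.real_smul, abs_inv, abs_neg,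
      abs_of_pos Real.two_pi_pos]
  rw [complexCumulant_ofReal] at hinversion
  have hexp : Real.exp (levyCumulant ν β - x * β) =
      Real.exp (levyCumulant ν β) / Real.exp (β * x) := by
    rw [← Real.exp_sub, mul_comm x]
  rw [hexp, eq_comm]
  push_cast at hinversion ⊢
  field_simp at hinversion ⊢
  linear_combination -hinversion

end Inversion

section Gaussian

theorem integrable_gaussian_mul_abs_pow {b : ℝ} (hb : 0 < b) (n : ℕ) :
    Integrable fun t : ℝ => Real.exp (-(b * t ^ 2)) * |t| ^ n := by
  have hn : (-1 : ℝ) < n := neg_one_lt_zero.trans_le n.cast_nonneg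
  refine (integrable_rpow_mul_exp_neg_mul_sq hb hn).norm.congr (Eventually.of_forall fun t => ?_)
  simp [mul_comm]

theorem integral_gaussian_mul_abs_pow_odd {b : ℝ} (hb : 0 < b) (n : ℕ) :
    ∫ t : ℝ, Real.exp (-(b * t ^ 2)) * |t| ^ (2 * n + 1) = n.factorial / b ^ (n + 1) := by
  have hradial := integral_comp_abs (f := fun t : ℝ => Real.exp (-(b * t ^ 2)) * t ^ (2 * n + 1))
  have hgamma := integral_rpow_mul_exp_neg_mul_rpow (p := 2) (q := (2 * n + 1 : ℕ)) two_pos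
    (neg_one_lt_zero.trans_le (Nat.cast_nonneg _)) hb
  have hexponent : (((2 * n + 1 : ℕ) : ℝ) + 1) / 2 = n + 1 := by push_cast; ring
  simp only [sq_abs] at hradial
  simp only [Real.rpow_natCast, Real.rpow_two, neg_mul] at hgamma
  rw [hradial]
  simp_rw [mul_comm (Real.exp _)]
  rw [hgamma, neg_div, hexponent, Real.Gamma_nat_eq_factorial, Real.rpow_neg hb.le,
    ← Nat.cast_succ, Real.rpow_natCast, Nat.succ_eq_add_one]
  ring

theorem integrable_gaussian_mul_abs_add_abs_cube {b : ℝ} (hb : 0 < b) (p q : ℝ) :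
    Integrable fun t : ℝ => Real.exp (-(b * t ^ 2)) * (p * |t| + q * |t| ^ 3) := by
  refine (((integrable_gaussian_mul_abs_pow hb 1).const_mul p).add
    ((integrable_gaussian_mul_abs_pow hb 3).const_mul q)).congr (Eventually.of_forall fun t => ?_)
  simp only [Pi.add_apply]
  ring

theorem integral_gaussian_mul_abs_add_abs_cube {b : ℝ} (hb : 0 < b) (p q : ℝ) :
    ∫ t : ℝ, Real.exp (-(b * t ^ 2)) * (p * |t| + q * |t| ^ 3) = p / b + q / b ^ 2 := by
  have hexpand (t : ℝ) : Real.exp (-(b * t ^ 2)) * (p * |t| + q * |t| ^ 3) =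
      p * (Real.exp (-(b * t ^ 2)) * |t| ^ (2 * 0 + 1)) +
        q * (Real.exp (-(b * t ^ 2)) * |t| ^ (2 * 1 + 1)) := by ring
  simp_rw [hexpand]
  rw [integral_add ((integrable_gaussian_mul_abs_pow hb _).const_mul p)
    ((integrable_gaussian_mul_abs_pow hb _).const_mul q), integral_const_mul, integral_const_mul,
    integral_gaussian_mul_abs_pow_odd hb, integral_gaussian_mul_abs_pow_odd hb]
  simp [div_eq_mul_inv]

theorem exp_neg_mul_sq_add_le {u v t r : ℝ} (hu : 0 ≤ u) (huv : u / 4 ≤ v) (ht : |t| ≤ 1 / 4)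
    (hr : r ≤ 2 / 9 * |t| ^ 3 * u) :
    Real.exp (-(v / 2 * t ^ 2) + r) ≤ Real.exp (-(u / 16 * t ^ 2)) := by
  have hcube : |t| ^ 3 * u ≤ 1 / 4 * t ^ 2 * u := by
    rw [pow_succ', sq_abs]
    gcongr
  have hquad : u / 4 * t ^ 2 ≤ v * t ^ 2 := mul_le_mul_of_nonneg_right huv (sq_nonneg t)
  have hnonneg : 0 ≤ u * t ^ 2 := mul_nonneg hu (sq_nonneg t)
  exact Real.exp_le_exp.2 (by linarith)

theorem exp_neg_mul_sq_le {u v : ℝ} (hu : 0 ≤ u) (huv : u / 4 ≤ v) (t : ℝ) :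
    Real.exp (-(v / 2 * t ^ 2)) ≤ Real.exp (-(u / 16 * t ^ 2)) := by
  refine Real.exp_le_exp.2 (neg_le_neg (mul_le_mul_of_nonneg_right ?_ (sq_nonneg t)))
  linarith

theorem tendsto_exp_neg_mul_exp_mul_exp {κ c : ℝ} (hκ : 0 < κ) (hc : 0 < c) (B d : ℝ) :
    Tendsto (fun β : ℝ => Real.exp (-(κ * Real.exp (c * β))) * (B * Real.exp (d * β)))
      atTop (𝓝 0) := by
  have hexp : Tendsto (fun β : ℝ => Real.exp (c * β)) atTop atTop :=
    Real.tendsto_exp_atTop.comp (tendsto_id.const_mul_atTop hc)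
  have hlim := ((tendsto_rpow_mul_exp_neg_mul_atTop_nhds_zero (d / c) κ hκ).comp hexp).const_mul B
  rw [mul_zero] at hlim
  refine hlim.congr fun β => ?_
  rw [Function.comp_apply, ← Real.exp_mul, mul_right_comm, mul_div_cancel₀ _ hc.ne', neg_mul]
  ring

end Gaussian

section SaddleIntegral

variable {ν : Measure ℝ}

theorem norm_cexp_add_mul_I_sub_one_le (z : ℂ) (θ : ℝ) :
    ‖Complex.exp (z + θ * I) - 1‖ ≤ Real.exp ‖z‖ * (‖z‖ + |θ|) := by
  have hz : ‖Complex.exp z - 1‖ ≤ ‖z‖ * Real.exp ‖z‖ := by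
    simpa using Complex.norm_exp_sub_sum_le_norm_mul_exp z 1
  have hθ : ‖Complex.exp (θ * I) - 1‖ ≤ |θ| := by
    simpa only [mul_comm I, Real.norm_eq_abs] using Real.norm_exp_I_mul_ofReal_sub_one_le (x := θ)
  have hsplit : Complex.exp (z + θ * I) - 1 =
      (Complex.exp z - 1) * Complex.exp (θ * I) + (Complex.exp (θ * I) - 1) := by
    rw [Complex.exp_add]
    ring
  calc ‖Complex.exp (z + θ * I) - 1‖ ≤ ‖Complex.exp z - 1‖ + ‖Complex.exp (θ * I) - 1‖ := by
        rw [hsplit]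
        refine (norm_add_le _ _).trans_eq ?_
        rw [norm_mul, Complex.norm_exp_ofReal_mul_I, mul_one]
    _ ≤ ‖z‖ * Real.exp ‖z‖ + Real.exp ‖z‖ * |θ| := add_le_add hz
        (hθ.trans (le_mul_of_one_le_left (abs_nonneg _) (Real.one_le_exp (norm_nonneg _))))
    _ = Real.exp ‖z‖ * (‖z‖ + |θ|) := by ring

theorem norm_cexp_complexCumulant_sub_gaussian_le [IsFiniteMeasure ν]
    (hν : ∀ᵐ x ∂ν, x ∈ Ioc (0 : ℝ) 1) {β y t : ℝ} (hy : 0 ≤ y)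
    (hmoment : expMoment ν 0 β / 4 ≤ expMoment ν 1 β) (ht : |t| ≤ 1 / 4) :
    ‖Complex.exp (complexCumulant ν (β + t * I) - complexCumulant ν β -
          t * (expMoment ν 0 β + y : ℝ) * I) - Real.exp (-(expMoment ν 1 β / 2 * t ^ 2))‖ ≤
      Real.exp (-(expMoment ν 0 β / 16 * t ^ 2)) *
        (2 / 9 * |t| ^ 3 * expMoment ν 0 β + |t| * y) := by
  have hremainder := norm_complexCumulant_taylor_le hν β (t := t) (by linarith)
  have hu := expMoment_nonneg hν 0 β
  set u := expMoment ν 0 β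
  set v := expMoment ν 1 β
  set R : ℂ := complexCumulant ν (β + t * I) - complexCumulant ν β
      - (t * u * I - t ^ 2 / 2 * v) with hR
  have hexponent : complexCumulant ν (β + t * I) - complexCumulant ν β - t * (u + y : ℝ) * I =
      (-(v / 2 * t ^ 2) : ℝ) + (R + (-(t * y) : ℝ) * I) := by
    rw [hR]
    push_cast
    ring
  calc ‖Complex.exp (complexCumulant ν (β + t * I) - complexCumulant ν β -
          t * (u + y : ℝ) * I) - Real.exp (-(v / 2 * t ^ 2))‖
      = Real.exp (-(v / 2 * t ^ 2)) * ‖Complex.exp (R + (-(t * y) : ℝ) * I) - 1‖ := by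
        rw [hexponent, Complex.exp_add, ← Complex.ofReal_exp, ← mul_sub_one, norm_mul,
          Complex.norm_real, Real.norm_eq_abs, Real.abs_exp]
    _ ≤ Real.exp (-(v / 2 * t ^ 2)) * (Real.exp ‖R‖ * (‖R‖ + |-(t * y)|)) :=
        mul_le_mul_of_nonneg_left (norm_cexp_add_mul_I_sub_one_le _ _) (Real.exp_pos _).le
    _ = Real.exp (-(v / 2 * t ^ 2) + ‖R‖) * (‖R‖ + |t| * y) := by
        rw [Real.exp_add, mul_assoc, abs_neg, abs_mul, abs_of_nonneg hy]
    _ ≤ Real.exp (-(u / 16 * t ^ 2)) * (2 / 9 * |t| ^ 3 * u + |t| * y) :=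
        mul_le_mul (exp_neg_mul_sq_add_le hu hmoment ht hremainder)
          (add_le_add_left hremainder _)
          (add_nonneg (norm_nonneg _) (mul_nonneg (abs_nonneg _) hy)) (Real.exp_pos _).le

theorem norm_complexMGF_sq_sub_expMoment_sq_le [IsFiniteMeasure ν]
    (hν : ∀ᵐ x ∂ν, x ∈ Ioc (0 : ℝ) 1) (β t : ℝ) :
    ‖complexMGF id ν (β + t * I) ^ 2 - (expMoment ν 0 β : ℂ) ^ 2‖ ≤
      2 * |t| * expMoment ν 0 β ^ 2 := by
  have hu := expMoment_nonneg hν 0 β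
  have hadd : ‖complexMGF id ν (β + t * I) + expMoment ν 0 β‖ ≤ 2 * expMoment ν 0 β := by
    rw [two_mul]
    exact norm_add_le_of_le (norm_complexMGF_le_expMoment β t) (Complex.norm_of_nonneg hu).le
  have hsub : ‖complexMGF id ν (β + t * I) - expMoment ν 0 β‖ ≤ |t| * expMoment ν 0 β :=
    (norm_complexMGF_sub_expMoment_le hν β t).trans
      (mul_le_mul_of_nonneg_left (expMoment_succ_le hν 0 β) (abs_nonneg t))
  rw [sq_sub_sq, norm_mul]
  exact (mul_le_mul hadd hsub (norm_nonneg _) (by positivity)).trans_eq (by ring)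

theorem norm_inversionIntegrand_sub_le_of_abs_le [IsFiniteMeasure ν]
    (hν : ∀ᵐ x ∂ν, x ∈ Ioc (0 : ℝ) 1) {β y t : ℝ} (hy : 0 ≤ y)
    (hmoment : expMoment ν 0 β / 4 ≤ expMoment ν 1 β) (ht : |t| ≤ 1 / 4) :
    ‖inversionIntegrand ν β (expMoment ν 0 β + y) t -
        (expMoment ν 0 β ^ 2 * Real.exp (-(expMoment ν 1 β / 2 * t ^ 2)) : ℝ)‖ ≤
      expMoment ν 0 β ^ 2 * (Real.exp (-(expMoment ν 0 β / 16 * t ^ 2)) *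
        ((2 + y) * |t| + expMoment ν 0 β * |t| ^ 3)) := by
  have hfactor := norm_complexMGF_sq_sub_expMoment_sq_le hν β t
  have hexp := norm_cexp_complexCumulant_sub_gaussian_le hν hy hmoment ht
  have hmgf := norm_complexMGF_le_expMoment (ν := ν) β t
  have hu := expMoment_nonneg hν 0 β
  have hgauss := exp_neg_mul_sq_le hu hmoment t
  rw [inversionIntegrand]
  set u := expMoment ν 0 β
  set G := Real.exp (-(expMoment ν 1 β / 2 * t ^ 2))
  set E := Real.exp (-(u / 16 * t ^ 2))
  set K := complexMGF id ν (β + t * I)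
  set φ := Complex.exp (complexCumulant ν (β + t * I) - complexCumulant ν β - t * (u + y : ℝ) * I)
  have hsplit : K ^ 2 * φ - (u ^ 2 * G : ℝ) = K ^ 2 * (φ - G) + (K ^ 2 - (u : ℂ) ^ 2) * G := by
    push_cast
    ring
  calc ‖K ^ 2 * φ - (u ^ 2 * G : ℝ)‖ ≤ ‖K‖ ^ 2 * ‖φ - G‖ + ‖K ^ 2 - (u : ℂ) ^ 2‖ * G := by
        rw [hsplit]
        refine (norm_add_le _ _).trans_eq ?_
        rw [norm_mul, norm_mul, norm_pow, Complex.norm_of_nonneg (Real.exp_pos _).le]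
    _ ≤ u ^ 2 * (E * (2 / 9 * |t| ^ 3 * u + |t| * y)) + 2 * |t| * u ^ 2 * E :=
        add_le_add (mul_le_mul (pow_le_pow_left₀ (norm_nonneg _) hmgf 2) hexp (norm_nonneg _)
          (sq_nonneg u)) (mul_le_mul hfactor hgauss (Real.exp_pos _).le (by positivity))
    _ = u ^ 2 * (E * ((2 + y) * |t| + 2 / 9 * (u * |t| ^ 3))) := by ring
    _ ≤ u ^ 2 * (E * ((2 + y) * |t| + u * |t| ^ 3)) := by
        have hcube : 2 / 9 * (u * |t| ^ 3) ≤ u * |t| ^ 3 :=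
          mul_le_of_le_one_left (mul_nonneg hu (by positivity)) (by norm_num)
        exact mul_le_mul_of_nonneg_left
          (mul_le_mul_of_nonneg_left (by linarith) (Real.exp_pos _).le) (sq_nonneg u)

theorem norm_inversionIntegrand (ν : Measure ℝ) (β x t : ℝ) :
    ‖inversionIntegrand ν β x t‖ = ‖complexMGF id ν (β + t * I)‖ ^ 2 *
      ‖Complex.exp (complexCumulant ν (β + t * I) - complexCumulant ν β)‖ := by
  rw [inversionIntegrand, norm_mul, norm_pow, Complex.norm_exp, Complex.norm_exp]
  simp

theorem integrable_inversionIntegrand [IsFiniteMeasure ν] (hν : ∀ᵐ x ∂ν, x ∈ Ioc (0 : ℝ) 1)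
    {β : ℝ} (hmgf : Integrable fun t : ℝ => ‖complexMGF id ν (β + t * I)‖ ^ 2) (x : ℝ) :
    Integrable (inversionIntegrand ν β x) := by
  have hentire : Differentiable ℂ (complexCumulant ν) :=
    fun z => (hasDerivAt_complexCumulant hν z).differentiableAt
  have hcumulant : Continuous (complexCumulant ν) := hentire.continuous
  have hmgf_cont : Continuous (complexMGF id ν) := by
    rw [← funext fun z => (hasDerivAt_complexCumulant hν z).deriv]
    exact (hentire.contDiff (n := 1)).continuous_deriv le_rfl
  refine hmgf.mono' ?_ (Eventually.of_forall fun t => ?_)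
  · refine Continuous.aestronglyMeasurable ?_
    unfold inversionIntegrand
    fun_prop
  · refine (norm_inversionIntegrand ν β x t).trans_le (mul_le_of_le_one_right (sq_nonneg _) ?_)
    rw [Complex.norm_exp, Real.exp_le_one_iff]
    refine (re_complexCumulant_sub_le hν β t).trans (neg_nonpos.2 (integral_nonneg fun y => ?_))
    exact mul_nonneg (sub_nonneg.2 (Real.cos_le_one _)) (Real.exp_pos _).le

theorem norm_inversionIntegrand_sub_le [IsFiniteMeasure ν] (hν : ∀ᵐ x ∂ν, x ∈ Ioc (0 : ℝ) 1)
    {η β y : ℝ} (hη_nonneg : 0 ≤ η)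
    (hη : ∀ t : ℝ, 1 / 4 ≤ |t| →
      ‖Complex.exp (complexCumulant ν (β + t * I) - complexCumulant ν β)‖ ≤ η)
    (hy : 0 ≤ y) (hmoment : expMoment ν 0 β / 4 ≤ expMoment ν 1 β) (t : ℝ) :
    ‖inversionIntegrand ν β (expMoment ν 0 β + y) t -
        (expMoment ν 0 β ^ 2 * Real.exp (-(expMoment ν 1 β / 2 * t ^ 2)) : ℝ)‖ ≤
      expMoment ν 0 β ^ 2 * (Real.exp (-(expMoment ν 0 β / 16 * t ^ 2)) *
        ((4 + y) * |t| + expMoment ν 0 β * |t| ^ 3)) +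
      η * ‖complexMGF id ν (β + t * I)‖ ^ 2 := by
  have hu := expMoment_nonneg hν 0 β
  rcases le_total |t| (1 / 4) with ht | ht
  · refine (norm_inversionIntegrand_sub_le_of_abs_le hν hy hmoment ht).trans
      (le_add_of_le_of_nonneg ?_ (by positivity))
    gcongr
    norm_num
  · refine (norm_sub_le _ _).trans ((add_le_add ?_ ?_).trans_eq (add_comm _ _))
    · rw [norm_inversionIntegrand, mul_comm]
      exact mul_le_mul_of_nonneg_right (hη t ht) (sq_nonneg _)
    · rw [Complex.norm_of_nonneg (by positivity)]
      refine mul_le_mul_of_nonneg_left ?_ (sq_nonneg _)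
      refine (exp_neg_mul_sq_le hu hmoment t).trans
        (le_mul_of_one_le_right (Real.exp_pos _).le ?_)
      have hcube : 0 ≤ expMoment ν 0 β * |t| ^ 3 := by positivity
      linarith [mul_nonneg hy (abs_nonneg t)]

theorem norm_integral_inversionIntegrand_sub_le [IsFiniteMeasure ν]
    (hν : ∀ᵐ x ∂ν, x ∈ Ioc (0 : ℝ) 1) {η β y : ℝ} (hη_nonneg : 0 ≤ η)
    (hη : ∀ t : ℝ, 1 / 4 ≤ |t| →
      ‖Complex.exp (complexCumulant ν (β + t * I) - complexCumulant ν β)‖ ≤ η)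
    (hmgf : Integrable fun t : ℝ => ‖complexMGF id ν (β + t * I)‖ ^ 2) (hy : 0 ≤ y)
    (hpos : 0 < expMoment ν 0 β) (hmoment : expMoment ν 0 β / 4 ≤ expMoment ν 1 β) :
    ‖(∫ t, inversionIntegrand ν β (expMoment ν 0 β + y) t) -
        (expMoment ν 0 β ^ 2 * √(2 * Real.pi / expMoment ν 1 β) : ℝ)‖ ≤
      expMoment ν 0 β * (16 * (4 + y) + 256) +
        η * ∫ t : ℝ, ‖complexMGF id ν (β + t * I)‖ ^ 2 := by
  have hpointwise := norm_inversionIntegrand_sub_le hν hη_nonneg hη hy hmoment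
  have hinversion := integrable_inversionIntegrand hν hmgf (expMoment ν 0 β + y)
  set u := expMoment ν 0 β
  set v := expMoment ν 1 β
  have hgauss : Integrable fun t : ℝ => u ^ 2 * Real.exp (-(v / 2 * t ^ 2)) := by
    simpa only [neg_mul] using
      (integrable_exp_neg_mul_sq (b := v / 2) (by linarith)).const_mul (u ^ 2)
  have hgauss_integral : ((u ^ 2 * √(2 * Real.pi / v) : ℝ) : ℂ) =
      ∫ t : ℝ, ((u ^ 2 * Real.exp (-(v / 2 * t ^ 2)) : ℝ) : ℂ) := by
    rw [integral_complex_ofReal, integral_const_mul, mul_comm 2, ← div_div_eq_mul_div,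
      ← integral_gaussian]
    simp only [neg_mul]
  have herror := (integrable_gaussian_mul_abs_add_abs_cube (b := u / 16) (by positivity)
    (4 + y) u).const_mul (u ^ 2)
  calc ‖(∫ t, inversionIntegrand ν β (u + y) t) - (u ^ 2 * √(2 * Real.pi / v) : ℝ)‖
      = ‖∫ t, (inversionIntegrand ν β (u + y) t -
          (u ^ 2 * Real.exp (-(v / 2 * t ^ 2)) : ℝ))‖ := by
        rw [hgauss_integral]
        exact congrArg norm (integral_sub hinversion hgauss.ofReal).symm
    _ ≤ ∫ t, (u ^ 2 * (Real.exp (-(u / 16 * t ^ 2)) * ((4 + y) * |t| + u * |t| ^ 3)) +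
          η * ‖complexMGF id ν (β + t * I)‖ ^ 2) :=
        norm_integral_le_of_norm_le (herror.add (hmgf.const_mul η))
          (Eventually.of_forall hpointwise)
    _ = u * (16 * (4 + y) + 256) + η * ∫ t : ℝ, ‖complexMGF id ν (β + t * I)‖ ^ 2 := by
        rw [integral_add herror (hmgf.const_mul η), integral_const_mul, integral_const_mul,
          integral_gaussian_mul_abs_add_abs_cube (by positivity), add_left_inj]
        field_simp
        ring

theorem IsLevyKernel.exists_norm_integral_inversionIntegrand_sub_le {k : ℝ → ℝ} {M δ : ℝ}
    (hk : IsLevyKernel k M δ) :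
    ∃ A ≥ 0, ∀ᶠ β in atTop, ∀ y ≥ 0,
      ‖(∫ t, inversionIntegrand (kernelMeasure k) β (expMoment (kernelMeasure k) 0 β + y) t) -
        (expMoment (kernelMeasure k) 0 β ^ 2 *
          √(2 * Real.pi / expMoment (kernelMeasure k) 1 β) : ℝ)‖ ≤
      A * (expMoment (kernelMeasure k) 0 β * (1 + y)) := by
  have := hk.isFiniteMeasure
  have hν := hk.ae_mem_Ioc
  obtain ⟨κ, hκ, hdamping⟩ := hk.exists_norm_cexp_complexCumulant_sub_le (τ := 1 / 4) (by norm_num)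
  have hsmall := tendsto_exp_neg_mul_exp_mul_exp hκ (c := 1 - δ) (by linarith [hk.le_quarter])
    (2 * Real.pi * M ^ 2) 2
  refine ⟨321, by norm_num, ?_⟩
  filter_upwards [eventually_ge_atTop 0, hk.eventually_expMoment_zero_div_four_le,
    (tendsto_expMoment_atTop hν hk.kernelMeasure_ne_zero 0).eventually_ge_atTop 1,
    hsmall.eventually_le_const one_pos] with β hβ hmoment hu hβ_small y hy
  have hmain := norm_integral_inversionIntegrand_sub_le hν (Real.exp_pos _).le
    (fun t => hdamping β t hβ) (hk.integrable_norm_sq_complexMGF β) hy (one_pos.trans_le hu) hmoment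
  have htail : Real.exp (-(κ * Real.exp (β * (1 - δ)))) *
      ∫ t : ℝ, ‖complexMGF id (kernelMeasure k) (β + t * I)‖ ^ 2 ≤ 1 := by
    refine (mul_le_mul_of_nonneg_left (hk.integral_norm_sq_complexMGF_le β)
      (Real.exp_pos _).le).trans (le_of_eq_of_le ?_ hβ_small)
    rw [abs_of_nonneg hβ, mul_pow, ← Real.exp_nat_mul, mul_comm β]
    push_cast
    ring
  nlinarith [mul_nonneg (zero_le_one.trans hu) hy]

end SaddleIntegral

section Asymptotics

/-- The factor `1 / (√(2π) σ)` of the saddle point approximation, where `σ² = ∫ x e^{βx} dν(x)` is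
the second derivative of `levyCumulant ν` at `β`. -/
noncomputable def gaussianPeak (ν : Measure ℝ) (β : ℝ) : ℝ :=
  1 / (√(2 * Real.pi) * √(expMoment ν 1 β))

section GaussianPeak

variable {ν : Measure ℝ} {β : ℝ}

theorem gaussianPeak_eq (ν : Measure ℝ) (β : ℝ) :
    gaussianPeak ν β = √(2 * Real.pi / expMoment ν 1 β) / (2 * Real.pi) := by
  rw [gaussianPeak, Real.sqrt_div Real.two_pi_pos.le, div_right_comm, Real.sqrt_div_self', div_div]

theorem gaussianPeak_pos (hν : 0 < expMoment ν 1 β) : 0 < gaussianPeak ν β := by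
  unfold gaussianPeak
  positivity

theorem gaussianPeak_le_one (hν : 1 ≤ expMoment ν 1 β) : gaussianPeak ν β ≤ 1 := by
  have hpi : 1 ≤ √(2 * Real.pi) := Real.one_le_sqrt.2 (by linarith [Real.pi_gt_three])
  exact div_le_one_of_le₀ (one_le_mul_of_one_le_of_one_le hpi (Real.one_le_sqrt.2 hν))
    (by positivity)

theorem one_div_expMoment_le [IsFiniteMeasure ν] (hν : ∀ᵐ x ∂ν, x ∈ Ioc (0 : ℝ) 1)
    (hpos : 0 < expMoment ν 1 β) :
    1 / expMoment ν 0 β ≤ √(2 * Real.pi) * (1 / √(expMoment ν 0 β)) * gaussianPeak ν β := by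
  have hle := expMoment_succ_le hν 0 β
  have := Real.sqrt_pos.2 hpos
  have hsqrt_zero := Real.sqrt_pos.2 (hpos.trans_le hle)
  calc 1 / expMoment ν 0 β = 1 / (√(expMoment ν 0 β) * √(expMoment ν 0 β)) := by
        rw [Real.mul_self_sqrt (hpos.trans_le hle).le]
    _ ≤ 1 / (√(expMoment ν 0 β) * √(expMoment ν 1 β)) := by gcongr
    _ = √(2 * Real.pi) * (1 / √(expMoment ν 0 β)) * gaussianPeak ν β := by
        rw [gaussianPeak]
        field_simp

end GaussianPeak

theorem abs_sub_le_of_mem_Icc {A u y s F G : ℝ} (hA : 0 ≤ A) (hu : 2 ≤ u) (hy : 0 ≤ y)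
    (hF : 0 ≤ F) (hs : s ≤ 1) (hGs : |G - u ^ 2 * s| ≤ A * (u * (1 + y)))
    (hGF : G ∈ Icc ((u + y - 1) * ((u + y) * F)) ((u + y) * ((u + y) * F))) :
    |F - s| ≤ (2 + 2 * A) * ((1 + y) / u) := by
  obtain ⟨hGs_lower, hGs_upper⟩ := abs_le.1 hGs
  have hAy : 0 ≤ A * (1 + y) := by positivity
  have hu_pos : 0 < u := by linarith
  have habs : |F - s| * u = |(F - s) * u| := by rw [abs_mul, abs_of_pos hu_pos]
  rw [← mul_div_assoc, le_div_iff₀ hu_pos, habs, abs_le]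
  constructor
  · have hx : 0 < u + y := by linarith
    have hscaled : (u + y) * ((u + y) * (s - F)) ≤ (u + y) * (2 * y + A * (1 + y)) := by
      have hsq : ((u + y) ^ 2 - u ^ 2) * s ≤ (u + y) ^ 2 - u ^ 2 :=
        mul_le_of_le_one_right (by nlinarith) hs
      nlinarith [hGF.2, mul_nonneg hAy hy]
    have hdiff := le_of_mul_le_mul_left hscaled hx
    rcases le_total s F with hsF | hFs
    · nlinarith [mul_nonneg (sub_nonneg.2 hsF) (by linarith : 0 ≤ u)]
    · nlinarith [mul_nonneg (sub_nonneg.2 hFs) hy]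
  · have hscaled : u * ((u - 1) * (F - s)) ≤ u * (1 + A * (1 + y)) := by
      have hmono : (u - 1) * (u * F) ≤ (u + y - 1) * ((u + y) * F) := by
        gcongr <;> linarith
      nlinarith [hGF.1]
    have hdiff := le_of_mul_le_mul_left hscaled (by linarith : 0 < u)
    rcases le_total F s with hFs | hsF
    · nlinarith [mul_nonneg (sub_nonneg.2 hFs) (by linarith : 0 ≤ u)]
    · nlinarith [mul_nonneg (sub_nonneg.2 hsF) (by linarith : 0 ≤ u - 2)]

theorem abs_setIntegral_Ioi_exp_mul_sub_le {h : ℝ → ℝ} {A s β : ℝ} (hβ : 2 ≤ β)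
    (hint : IntegrableOn (fun y => Real.exp (-β * y) * h y) (Ioi 0))
    (hbound : ∀ y ≥ 0, |h y - s| ≤ A * (1 + y)) :
    |(∫ y in Ioi 0, Real.exp (-β * y) * h y) - s / β| ≤ 2 * A / β := by
  have hA : 0 ≤ A := by simpa using (abs_nonneg _).trans (hbound 0 le_rfl)
  have integral_exp {b : ℝ} (hb : 0 < b) : ∫ y in Ioi (0 : ℝ), Real.exp (-b * y) = 1 / b := by
    rw [integral_exp_mul_Ioi (neg_neg_of_pos hb)]
    simp
  have hexp : IntegrableOn (fun y => Real.exp (-β * y)) (Ioi 0) :=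
    integrableOn_exp_mul_Ioi (by linarith) 0
  have hexp' : IntegrableOn (fun y => Real.exp (-(β - 1) * y)) (Ioi 0) :=
    integrableOn_exp_mul_Ioi (by linarith) 0
  calc |(∫ y in Ioi 0, Real.exp (-β * y) * h y) - s / β|
      = ‖∫ y in Ioi 0, (Real.exp (-β * y) * h y - Real.exp (-β * y) * s)‖ := by
        rw [integral_sub hint (hexp.mul_const s), integral_mul_const, integral_exp (by linarith),
          one_div_mul_eq_div, Real.norm_eq_abs]
    _ ≤ ∫ y in Ioi 0, Real.exp (-(β - 1) * y) * A := by
        refine norm_integral_le_of_norm_le (hexp'.mul_const A)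
          ((ae_restrict_mem measurableSet_Ioi).mono fun y hy => ?_)
        have hsplit : Real.exp (-(β - 1) * y) = Real.exp (-β * y) * Real.exp y := by
          rw [← Real.exp_add]
          ring_nf
        rw [← mul_sub, norm_mul, Real.norm_eq_abs, Real.abs_exp, hsplit, mul_assoc, mul_comm _ A]
        refine mul_le_mul_of_nonneg_left ((hbound y (le_of_lt hy)).trans ?_) (Real.exp_pos _).le
        exact mul_le_mul_of_nonneg_left (by linarith [Real.add_one_le_exp y]) hA
    _ = 1 / (β - 1) * A := by rw [integral_mul_const, integral_exp (by linarith)]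
    _ ≤ 2 / β * A := by
        refine mul_le_mul_of_nonneg_right ?_ hA
        rw [div_le_div_iff₀ (by linarith) (by linarith)]
        linarith
    _ = 2 * A / β := by ring

variable {k : ℝ → ℝ} {M δ : ℝ} {μ : Measure ℝ}

theorem IsLevyLaw.exists_abs_exp_mul_convDensity_conv_sub_le
    (h : IsLevyLaw μ (kernelMeasure k)) (hk : IsLevyKernel k M δ) :
    ∃ A ≥ 0, ∀ᶠ β in atTop, ∀ y ≥ 0,
      |Real.exp ((expMoment (kernelMeasure k) 0 β + y) * β - levyCumulant (kernelMeasure k) β) *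
          convDensity k (kernelMeasure k ∗ μ) (expMoment (kernelMeasure k) 0 β + y) -
        expMoment (kernelMeasure k) 0 β ^ 2 * gaussianPeak (kernelMeasure k) β| ≤
      A * (expMoment (kernelMeasure k) 0 β * (1 + y)) := by
  obtain ⟨A, hA, hev⟩ := hk.exists_norm_integral_inversionIntegrand_sub_le
  have hpi : 0 < (2 * Real.pi)⁻¹ := inv_pos.2 Real.two_pi_pos
  refine ⟨(2 * Real.pi)⁻¹ * A, by positivity, hev.mono fun β hβ y hy => ?_⟩
  have hinversion := h.convDensity_conv_eq_integral_inversionIntegrand hk.toIsBoundedKernel β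
    (expMoment (kernelMeasure k) 0 β + y)
  replace hβ := hβ y hy
  set ν := kernelMeasure k
  set u := expMoment ν 0 β
  set J := ∫ t, inversionIntegrand ν β (u + y) t
  have hscaled : ((Real.exp ((u + y) * β - levyCumulant ν β) * convDensity k (ν ∗ μ) (u + y) -
      u ^ 2 * gaussianPeak ν β : ℝ) : ℂ) =
      ((2 * Real.pi)⁻¹ : ℝ) * (J - (u ^ 2 * √(2 * Real.pi / expMoment ν 1 β) : ℝ)) := by
    have hcancel : Real.exp ((u + y) * β - levyCumulant ν β) *
        (Real.exp (levyCumulant ν β - (u + y) * β) / (2 * Real.pi)) = (2 * Real.pi)⁻¹ := by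
      rw [← mul_div_assoc, ← Real.exp_add, sub_add_sub_cancel, sub_self, Real.exp_zero, one_div]
    rw [Complex.ofReal_sub, Complex.ofReal_mul, hinversion, ← mul_assoc, ← Complex.ofReal_mul,
      hcancel, gaussianPeak_eq, mul_sub, ← Complex.ofReal_mul, div_eq_inv_mul, mul_left_comm]
  rw [← Real.norm_eq_abs, ← Complex.norm_real, hscaled, norm_mul, Complex.norm_of_nonneg hpi.le,
    mul_assoc]
  exact mul_le_mul_of_nonneg_left hβ hpi.le

namespace IsDefectiveDensity

variable {f : ℝ → ℝ}

theorem exists_abs_exp_mul_sub_gaussianPeak_le (hf : IsDefectiveDensity μ f)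
    (h : IsLevyLaw μ (kernelMeasure k)) (hk : IsLevyKernel k M δ)
    (hf_cont : ContinuousOn f (Ioi 1)) :
    ∃ A ≥ 0, ∀ᶠ β in atTop, ∀ y ≥ 0,
      |Real.exp ((expMoment (kernelMeasure k) 0 β + y) * β - levyCumulant (kernelMeasure k) β) *
          f (expMoment (kernelMeasure k) 0 β + y) - gaussianPeak (kernelMeasure k) β| ≤
      A * ((1 + y) / expMoment (kernelMeasure k) 0 β) := by
  have := hk.isFiniteMeasure
  obtain ⟨A, hA, hev⟩ := h.exists_abs_exp_mul_convDensity_conv_sub_le hk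
  have hmoment := tendsto_expMoment_atTop hk.ae_mem_Ioc hk.kernelMeasure_ne_zero
  refine ⟨2 + 2 * A, by positivity, ?_⟩
  filter_upwards [hev, (hmoment 0).eventually_ge_atTop 2, (hmoment 1).eventually_ge_atTop 1]
    with β hβ hu hv y hy
  set u := expMoment (kernelMeasure k) 0 β
  set E := Real.exp ((u + y) * β - levyCumulant (kernelMeasure k) β)
  have hE : 0 ≤ E := (Real.exp_pos _).le
  have hmem := h.convDensity_conv_mem_Icc hk.toIsBoundedKernel (u + y)
  rw [← hf.mul_eq_convDensity h hk.toIsBoundedKernel hf_cont (by linarith)] at hmem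
  refine abs_sub_le_of_mem_Icc hA hu hy (mul_nonneg hE (hf.2.1 _)) (gaussianPeak_le_one hv)
    (hβ y hy) ⟨?_, ?_⟩
  · exact (le_of_eq (by ring)).trans (mul_le_mul_of_nonneg_left hmem.1 hE)
  · exact (mul_le_mul_of_nonneg_left hmem.2 hE).trans_eq (by ring)

theorem measureReal_Ici [IsFiniteMeasure μ] (hf : IsDefectiveDensity μ f) {u : ℝ} (hu : 0 < u) :
    μ.real (Ici u) = ∫ y in Ioi 0, f (u + y) := by
  have hint : Integrable ((Ici u).indicator (1 : ℝ → ℝ)) μ :=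
    (integrable_const (1 : ℝ)).indicator measurableSet_Ici
  have hindicator : (fun x => f x * (Ici u).indicator 1 x) = (Ici u).indicator f := by
    ext x
    by_cases hx : x ∈ Ici u <;> simp [hx]
  have htranslate : ∫ y in Ioi 0, f (u + y) = ∫ x in Ioi u, f x := by
    simpa using (measurePreserving_add_left volume u).setIntegral_preimage_emb
      (measurableEmbedding_addLeft u) f (Ioi u)
  rw [htranslate, ← integral_Ici_eq_integral_Ioi, ← integral_indicator measurableSet_Ici,
    ← hindicator, ← integral_indicator_one measurableSet_Ici,
    hf.integral_eq hint,
    indicator_of_notMem (by simpa using hu), mul_zero, zero_add]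

theorem exists_abs_exp_mul_measureReal_Ici_sub_le (hf : IsDefectiveDensity μ f)
    (h : IsLevyLaw μ (kernelMeasure k)) (hk : IsLevyKernel k M δ)
    (hf_cont : ContinuousOn f (Ioi 1)) :
    ∃ A ≥ 0, ∀ᶠ β in atTop,
      |Real.exp (expMoment (kernelMeasure k) 0 β * β - levyCumulant (kernelMeasure k) β) *
          μ.real (Ici (expMoment (kernelMeasure k) 0 β)) - gaussianPeak (kernelMeasure k) β / β| ≤
      A * (1 / expMoment (kernelMeasure k) 0 β / β) := by
  have := hk.isFiniteMeasure
  have := h.isProbabilityMeasure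
  obtain ⟨A, hA, hev⟩ := hf.exists_abs_exp_mul_sub_gaussianPeak_le h hk hf_cont
  refine ⟨2 * A, by positivity, ?_⟩
  filter_upwards [hev, eventually_ge_atTop 2] with β hbound hβ
  have hu := expMoment_pos hk.ae_mem_Ioc hk.kernelMeasure_ne_zero 0 β
  set u := expMoment (kernelMeasure k) 0 β
  set c := levyCumulant (kernelMeasure k) β
  have htilt (y : ℝ) : Real.exp (u * β - c) * f (u + y) =
      Real.exp (-β * y) * (Real.exp ((u + y) * β - c) * f (u + y)) := by
    rw [← mul_assoc, ← Real.exp_add]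
    ring_nf
  have hint : Integrable fun y => Real.exp (-β * y) * (Real.exp ((u + y) * β - c) * f (u + y)) := by
    simpa only [htilt] using (hf.integrable.comp_add_left u).const_mul (Real.exp (u * β - c))
  rw [hf.measureReal_Ici hu, ← integral_const_mul]
  simp_rw [htilt]
  refine (abs_setIntegral_Ioi_exp_mul_sub_le hβ hint.integrableOn (A := A / u)
    fun y hy => (hbound y hy).trans_eq ?_).trans_eq ?_ <;> ring

end IsDefectiveDensity

end Asymptotics

section RelativeError

theorem EqWithRelError.of_abs_sub_le {F G r : ℝ → ℝ} (B : ℝ)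
    (h : ∀ᶠ u in atTop, G u ≠ 0 ∧ |F u - G u| ≤ B * |r u| * |G u|) : EqWithRelError F G r := by
  refine ⟨fun u => F u / G u - 1, Asymptotics.IsBigO.of_bound B (h.mono fun u hu => ?_),
    h.mono fun u hu => ?_⟩
  · rw [Real.norm_eq_abs, Real.norm_eq_abs, div_sub_one hu.1, abs_div,
      div_le_iff₀ (abs_pos.2 hu.1)]
    exact hu.2
  · rw [add_sub_cancel, mul_div_cancel₀ _ hu.1]

theorem EqWithRelError.div_trans {f p S b r : ℝ → ℝ} (hr : Tendsto r atTop (𝓝 0))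
    (hf : EqWithRelError f S r) (hp : EqWithRelError p (fun u => 1 / b u * S u) r) :
    EqWithRelError p (fun u => f u / b u) r := by
  obtain ⟨Rf, hRf, hf_eq⟩ := hf
  obtain ⟨Rp, hRp, hp_eq⟩ := hp
  have hone : Tendsto (fun u => 1 + Rf u) atTop (𝓝 1) := by
    simpa using (hRf.trans_tendsto hr).const_add 1
  have hinv : (fun u => (1 + Rf u)⁻¹) =O[atTop] fun _ => (1 : ℝ) :=
    (hone.inv₀ one_ne_zero).isBigO_one ℝ
  refine ⟨fun u => (Rp u - Rf u) * (1 + Rf u)⁻¹, by simpa using (hRp.sub hRf).mul hinv, ?_⟩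
  filter_upwards [hf_eq, hp_eq, hone.eventually_ne one_ne_zero] with u hfu hpu hne
  rw [hpu, hfu]
  field_simp
  ring

theorem EqWithRelError.of_abs_exp_mul_sub_le {ν : Measure ℝ} [IsFiniteMeasure ν]
    (hν : ∀ᵐ x ∂ν, x ∈ Ioc (0 : ℝ) 1) (hν_ne : ν ≠ 0) {β q F : ℝ → ℝ} {A : ℝ}
    (hβ : ∀ u > 0, expMoment ν 0 (β u) = u) (hA : 0 ≤ A) (hq : ∀ᶠ u in atTop, 0 < q u)
    (hF : ∀ᶠ u in atTop, |Real.exp (u * β u - levyCumulant ν (β u)) * F u -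
      q u * gaussianPeak ν (β u)| ≤ A * (q u * (1 / u))) :
    EqWithRelError F
      (fun u => q u * (Real.exp (levyCumulant ν (β u) - u * β u) * gaussianPeak ν (β u)))
      (fun u => 1 / √u) := by
  refine .of_abs_sub_le (A * √(2 * Real.pi)) ?_
  filter_upwards [hF, hq, eventually_gt_atTop 0] with u hFu hqu hu
  have hmoment := expMoment_pos hν hν_ne 1 (β u)
  have hpeak := gaussianPeak_pos hmoment
  have hinv := one_div_expMoment_le hν hmoment
  rw [hβ u hu] at hinv
  set s := gaussianPeak ν (β u)
  have hcancel : Real.exp (levyCumulant ν (β u) - u * β u) *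
      Real.exp (u * β u - levyCumulant ν (β u)) = 1 := by
    rw [← Real.exp_add, sub_add_sub_cancel, sub_self, Real.exp_zero]
  set E := Real.exp (levyCumulant ν (β u) - u * β u)
  have hE : 0 < E := Real.exp_pos _
  have hfactor : F u - q u * (E * s) =
      E * (Real.exp (u * β u - levyCumulant ν (β u)) * F u - q u * s) := by
    linear_combination -F u * hcancel
  refine ⟨by positivity, ?_⟩
  rw [hfactor, abs_mul, abs_of_pos hE, abs_of_pos (by positivity : 0 < 1 / √u),
    abs_of_pos (by positivity : 0 < q u * (E * s))]
  calc _ ≤ E * (A * (q u * (1 / u))) := mul_le_mul_of_nonneg_left hFu hE.le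
    _ ≤ E * (A * (q u * (√(2 * Real.pi) * (1 / √u) * s))) := by gcongr
    _ = A * √(2 * Real.pi) * (1 / √u) * (q u * (E * s)) := by ring

end RelativeError

section SaddlePoint

theorem exists_isLevyKernel_ae_eq {h : ℝ → ℝ} {M δ : ℝ}
    (hh : AEMeasurable h (volume.restrict (Ioc (0 : ℝ) 1)))
    (hh_nonneg : ∀ x ∈ Ioc (0 : ℝ) 1, 0 ≤ h x) (hh_le : ∀ x ∈ Ioc (0 : ℝ) 1, h x ≤ M)
    (hδ : 0 < δ) (hδ_le : δ ≤ 1 / 4) (hh_ge : ∀ x ∈ Icc (1 - δ) 1, δ ≤ h x) :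
    ∃ k, IsLevyKernel k M δ ∧ k =ᵐ[volume.restrict (Ioc 0 1)] h := by
  have hδM : δ ≤ M :=
    (hh_ge 1 (right_mem_Icc.2 (by linarith))).trans (hh_le 1 (right_mem_Ioc.2 one_pos))
  let l : ℝ → ℝ := (Icc (1 - δ) 1).indicator fun _ => δ
  have hl_nonneg (x : ℝ) : 0 ≤ l x := indicator_nonneg (fun _ _ => hδ.le) x
  have hl_le (x : ℝ) : l x ≤ δ := indicator_le_self' (fun _ _ => hδ.le) x
  have hl_le_h {x : ℝ} (hx : x ∈ Ioc (0 : ℝ) 1) : l x ≤ h x :=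
    indicator_apply_le' (hh_ge x) fun _ => hh_nonneg x hx
  refine ⟨(Ioc 0 1).indicator fun x => max (l x) (min M (hh.mk h x)), ?_, ?_⟩
  · refine ⟨⟨?_, ?_, ?_, fun x hx => indicator_of_notMem hx _⟩, hδ, hδ_le, fun x hx => ?_⟩
    · exact ((measurable_const.indicator measurableSet_Icc).max
        (measurable_const.min hh.measurable_mk)).indicator measurableSet_Ioc
    · exact indicator_nonneg fun x _ => (hl_nonneg x).trans (le_max_left _ _)
    · exact indicator_le' (fun x _ => max_le ((hl_le x).trans hδM) (min_le_left _ _))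
        (fun _ _ => hδ.le.trans hδM)
    · rw [indicator_of_mem (show x ∈ Ioc (0 : ℝ) 1 from ⟨by linarith [hx.1], hx.2⟩)]
      exact (indicator_of_mem hx fun _ => δ).ge.trans (le_max_left _ _)
  · filter_upwards [hh.ae_eq_mk, ae_restrict_mem measurableSet_Ioc] with x hx_eq hx
    rw [indicator_of_mem hx, ← hx_eq, min_eq_right (hh_le x hx), max_eq_right (hl_le_h hx)]

theorem exists_isLevyKernel {g : ℝ → ℝ}
    (hg_meas : AEMeasurable g (volume.restrict (Ioc (0 : ℝ) 1)))
    (hg_nonneg : ∀ x ∈ Ioc (0 : ℝ) 1, 0 ≤ g x)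
    (hg_sup : BddAbove ((fun x : ℝ => x * g x) '' Ioc (0 : ℝ) 1)) {ε : ℝ} (hε : 0 < ε)
    (hg_ge : ∀ x ∈ Ioc (0 : ℝ) 1, 1 - ε ≤ x → ε ≤ g x) :
    ∃ (k : ℝ → ℝ) (M δ : ℝ), IsLevyKernel k M δ ∧
      k =ᵐ[volume.restrict (Ioc 0 1)] fun x => x * g x := by
  obtain ⟨M, hM⟩ := hg_sup
  have hδ : min (ε / 2) (1 / 4) ≤ ε / 2 := min_le_left _ _
  have hδ_le : min (ε / 2) (1 / 4) ≤ 1 / 4 := min_le_right _ _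
  obtain ⟨k, hk⟩ := exists_isLevyKernel_ae_eq (aemeasurable_id.mul hg_meas)
    (fun x hx => mul_nonneg hx.1.le (hg_nonneg x hx)) (fun x hx => hM ⟨x, hx, rfl⟩)
    (by positivity) hδ_le fun x hx => by
      have hge := hg_ge x ⟨by linarith [hx.1], hx.2⟩ (by linarith [hx.1])
      simp only [Pi.mul_apply, id]
      nlinarith [hx.1]
  exact ⟨k, M, _, hk⟩

variable {k g f : ℝ → ℝ} {M δ : ℝ} {μ : Measure ℝ}

theorem IsBoundedKernel.cumulant_eq (hk : IsBoundedKernel k M)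
    (hkg : k =ᵐ[volume.restrict (Ioc 0 1)] fun x => x * g x) :
    cumulant g = levyCumulant (kernelMeasure k) := by
  ext θ
  rw [levyCumulant, hk.integral_kernelMeasure, cumulant,
    ← setIntegral_eq_integral_of_forall_compl_eq_zero (s := Ioc (0 : ℝ) 1)
      (f := fun x => k x • ((Real.exp (θ * x) - 1) / x))
      (fun x hx => by rw [hk.eq_zero x hx, zero_smul])]
  refine integral_congr_ae ?_
  filter_upwards [hkg, ae_restrict_mem measurableSet_Ioc] with x hx_eq hx
  have hx_ne := hx.1.ne'
  rw [hx_eq, smul_eq_mul]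
  field_simp

theorem IsBoundedKernel.deriv_cumulant (hk : IsBoundedKernel k M)
    (hkg : k =ᵐ[volume.restrict (Ioc 0 1)] fun x => x * g x) :
    deriv (cumulant g) = expMoment (kernelMeasure k) 0 := by
  have := hk.isFiniteMeasure
  rw [hk.cumulant_eq hkg, deriv_levyCumulant hk.ae_mem_Ioc]

theorem IsBoundedKernel.saddle_eq (hk : IsBoundedKernel k M)
    (hkg : k =ᵐ[volume.restrict (Ioc 0 1)] fun x => x * g x) (β u : ℝ) :
    saddle g β u = Real.exp (levyCumulant (kernelMeasure k) β - u * β) *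
      gaussianPeak (kernelMeasure k) β := by
  have := hk.isFiniteMeasure
  rw [saddle, hk.deriv_cumulant hkg, hk.cumulant_eq hkg, deriv_expMoment hk.ae_mem_Ioc,
    gaussianPeak, mul_one_div]

theorem IsLevyLaw.exists_isDefectiveDensity_continuousOn (h : IsLevyLaw μ (kernelMeasure k))
    (hk : IsBoundedKernel k M) : ∃ f, IsDefectiveDensity μ f ∧ ContinuousOn f (Ioi 1) := by
  have := h.isProbabilityMeasure
  have hf := h.isDefectiveDensity hk
  refine ⟨_, hf, ((hf.continuousOn_convDensity hk).div continuousOn_id fun x hx => ?_).congr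
    fun x hx => indicator_of_mem (zero_lt_one.trans hx) _⟩
  exact (zero_lt_one.trans hx).ne'

namespace IsDefectiveDensity

theorem eqWithRelError_saddle (hf : IsDefectiveDensity μ f) (h : IsLevyLaw μ (kernelMeasure k))
    (hk : IsLevyKernel k M δ) (hkg : k =ᵐ[volume.restrict (Ioc 0 1)] fun x => x * g x)
    (hf_cont : ContinuousOn f (Ioi 1)) {β : ℝ → ℝ} (hβ : ∀ u > 0, deriv (cumulant g) (β u) = u) :
    EqWithRelError f (fun u => saddle g (β u) u) (fun u => 1 / √u) := by
  have := hk.isFiniteMeasure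
  rw [hk.deriv_cumulant hkg] at hβ
  obtain ⟨A, hA, hev⟩ := hf.exists_abs_exp_mul_sub_gaussianPeak_le h hk hf_cont
  have htop := tendsto_atTop_of_expMoment_eq hk.ae_mem_Ioc hk.kernelMeasure_ne_zero hβ
  have hrel := EqWithRelError.of_abs_exp_mul_sub_le (q := fun _ => 1) (F := f) hk.ae_mem_Ioc
    hk.kernelMeasure_ne_zero hβ hA (Eventually.of_forall fun _ => one_pos) <| by
      filter_upwards [htop.eventually hev, eventually_gt_atTop 0] with u hbound hu
      simpa only [hβ u hu, add_zero, one_mul] using hbound 0 le_rfl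
  simpa only [hk.saddle_eq hkg, one_mul] using hrel

theorem eqWithRelError_measureReal_Ici (hf : IsDefectiveDensity μ f)
    (h : IsLevyLaw μ (kernelMeasure k)) (hk : IsLevyKernel k M δ)
    (hkg : k =ᵐ[volume.restrict (Ioc 0 1)] fun x => x * g x)
    (hf_cont : ContinuousOn f (Ioi 1)) {β : ℝ → ℝ} (hβ : ∀ u > 0, deriv (cumulant g) (β u) = u) :
    EqWithRelError (fun u => μ.real (Ici u)) (fun u => 1 / β u * saddle g (β u) u)
      (fun u => 1 / √u) := by
  have := hk.isFiniteMeasure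
  rw [hk.deriv_cumulant hkg] at hβ
  obtain ⟨A, hA, hev⟩ := hf.exists_abs_exp_mul_measureReal_Ici_sub_le h hk hf_cont
  have htop := tendsto_atTop_of_expMoment_eq hk.ae_mem_Ioc hk.kernelMeasure_ne_zero hβ
  simp only [hk.saddle_eq hkg]
  refine .of_abs_exp_mul_sub_le hk.ae_mem_Ioc hk.kernelMeasure_ne_zero hβ hA
    ((htop.eventually_gt_atTop 0).mono fun _ => one_div_pos.2) ?_
  filter_upwards [htop.eventually hev, eventually_gt_atTop 0] with u hbound hu
  simpa only [hβ u hu, one_div_mul_eq_div] using hbound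

end IsDefectiveDensity

end SaddlePoint

end LevyTail

theorem mainTheorem3_general
    {Ω : Type*} [MeasurableSpace Ω] (P : MeasureTheory.Measure Ω) (T : Ω → ℝ)
    (hT : AEMeasurable T P) (g : ℝ → ℝ)
    (hg_meas : AEMeasurable g (MeasureTheory.volume.restrict (Set.Ioc (0 : ℝ) 1)))
    (hg_nonneg : ∀ x ∈ Set.Ioc (0 : ℝ) 1, 0 ≤ g x)
    (hg_sup : BddAbove ((fun x : ℝ => x * g x) '' Set.Ioc (0 : ℝ) 1))
    (ε : ℝ) (hε : 0 < ε)
    (hg_ge : ∀ x ∈ Set.Ioc (0 : ℝ) 1, 1 - ε ≤ x → ε ≤ g x)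
    (hLevy : LevyTail.HasLevyDensity T P g) :
    (∀ u : ℝ, 0 < u → ∃! b : ℝ, deriv (LevyTail.cumulant g) b = u) ∧
    (∃ f : ℝ → ℝ, LevyTail.IsDefectiveDensity (P.map T) f ∧ ContinuousOn f (Set.Ioi 1)) ∧
    ∀ f : ℝ → ℝ, LevyTail.IsDefectiveDensity (P.map T) f → ContinuousOn f (Set.Ioi 1) →
    ∀ β : ℝ → ℝ, (∀ u : ℝ, 0 < u → deriv (LevyTail.cumulant g) (β u) = u) →
      LevyTail.EqWithRelError f
        (fun u => LevyTail.saddle g (β u) u) (fun u => 1 / Real.sqrt u) ∧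
      LevyTail.EqWithRelError (fun u => P.real {ω | u ≤ T ω})
        (fun u => 1 / β u * LevyTail.saddle g (β u) u) (fun u => 1 / Real.sqrt u) ∧
      LevyTail.EqWithRelError (fun u => P.real {ω | u ≤ T ω})
        (fun u => f u / β u) (fun u => 1 / Real.sqrt u) := by
  obtain ⟨k, M, δ, hk, hkg⟩ := LevyTail.exists_isLevyKernel hg_meas hg_nonneg hg_sup hε hg_ge
  have := hk.isFiniteMeasure
  have hlaw : LevyTail.IsLevyLaw (P.map T) (LevyTail.kernelMeasure k) := fun θ => by
    rw [ProbabilityTheory.mgf_id_map hT, hLevy θ, hk.cumulant_eq hkg]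
  have htail (u : ℝ) : (P.map T).real (Set.Ici u) = P.real {ω | u ≤ T ω} :=
    MeasureTheory.map_measureReal_apply_of_aemeasurable hT measurableSet_Ici
  refine ⟨fun u hu => ?_, hlaw.exists_isDefectiveDensity_continuousOn hk.toIsBoundedKernel,
    fun f hf hf_cont β hβ => ?_⟩
  · rw [hk.deriv_cumulant hkg]
    exact LevyTail.existsUnique_expMoment_eq hk.ae_mem_Ioc hk.kernelMeasure_ne_zero 0 hu
  · have hdensity := hf.eqWithRelError_saddle hlaw hk hkg hf_cont hβ
    have hprob := hf.eqWithRelError_measureReal_Ici hlaw hk hkg hf_cont hβ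
    simp only [htail] at hprob
    refine ⟨hdensity, hprob, .div_trans ?_ hdensity hprob⟩
    simp only [one_div]
    exact Real.tendsto_sqrt_atTop.inv_tendsto_atTop

theorem mainTheorem3
    {Ω : Type*} [MeasurableSpace Ω] (P : MeasureTheory.Measure Ω)
    [MeasureTheory.IsProbabilityMeasure P] (T : Ω → ℝ) (hT : AEMeasurable T P)
    (g : ℝ → ℝ)
    (hg_meas : AEMeasurable g (MeasureTheory.volume.restrict (Set.Ioc (0 : ℝ) 1)))
    (hg_nonneg : ∀ x ∈ Set.Ioc (0 : ℝ) 1, 0 ≤ g x)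
    (a : ℝ) (ha_pos : 0 < a) (ha_le : a ≤ 1 / 4)
    (hg_pw : LevyTail.PiecewiseContDiff 2 g a 1)
    (hg_sup : BddAbove ((fun x : ℝ => x * g x) '' Set.Ioc (0 : ℝ) 1))
    (ε : ℝ) (hε : 0 < ε)
    (hg_ge : ∀ x ∈ Set.Ioc (0 : ℝ) 1, 1 - ε ≤ x → ε ≤ g x)
    (hLevy : LevyTail.HasLevyDensity T P g) :
    -- for every `u > 0` the equation `C'(b) = u` has exactly one solution
    (∀ u : ℝ, 0 < u → ∃! b : ℝ, deriv (LevyTail.cumulant g) b = u) ∧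
    -- the law of `T` has a (possibly defective) density, with a version continuous on `(1, ∞)`
    (∃ f : ℝ → ℝ, LevyTail.IsDefectiveDensity (P.map T) f ∧ ContinuousOn f (Set.Ioi 1)) ∧
    -- the asymptotic formulas
    ∀ f : ℝ → ℝ, LevyTail.IsDefectiveDensity (P.map T) f → ContinuousOn f (Set.Ioi 1) →
    ∀ β : ℝ → ℝ, (∀ u : ℝ, 0 < u → deriv (LevyTail.cumulant g) (β u) = u) →
      LevyTail.EqWithRelError f
        (fun u => LevyTail.saddle g (β u) u) (fun u => 1 / Real.sqrt u) ∧
      LevyTail.EqWithRelError (fun u => P.real {ω | u ≤ T ω})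
        (fun u => 1 / β u * LevyTail.saddle g (β u) u) (fun u => 1 / Real.sqrt u) ∧
      LevyTail.EqWithRelError (fun u => P.real {ω | u ≤ T ω})
        (fun u => f u / β u) (fun u => 1 / Real.sqrt u) :=
  mainTheorem3_general P T hT g hg_meas hg_nonneg hg_sup ε hε hg_ge hLevy
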